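/- **Setting.** $N\ge1$ players; player $i$ chooses $x_i\in\mathbb R^{m}$ to minimize $f_i(x_i,x_i+\bar x_{-i})+r_i(x_i)$, where $\bar x_{-i}=\sum_{j\ne i}x_j$, $\bar x=\sum_j x_j$ and $f_i(x,y)=\mathbb E[\psi_i(x,y;\xi)]$ for a random vector $\xi$ in $\mathbb R^d$. Each $r_i$ is convex and lower semicontinuous with compact effective domain $\mathcal R_i$; $\mathcal R=\prod_i\mathcal R_i$, $\bar{\mathcal R}=\sum_i\mathcal R_i$, $M=\sum_j\max_{x\in\mathcal R_j}\|x\|$. For $h=f_i$ or $h=\psi_i(\cdot,\cdot;\xi)$, $\nabla_{x_i}h(x,y)$ denotes the gradient of $t\mapsto h(t,t+(y-x))$ at $t=x$, i.e. the gradient in the own decision with $\bar x_{-i}=y-x$ fixed. Let $Y\supseteq\bar{\mathcal R}$ be a set containing all the estimates $N\hat v_{i,k}$ of the aggregate that occur below. Assume: (a) for every $x\in\mathcal R$, $t\mapsto f_i(t,t+\bar x_{-i})$ is $C^1$ and convex on an open set containing $\mathcal R_i$; for $x\in\mathcal R_i$, $y\in Y$ the gradients $\nabla_{x_i}f_i(x,y)$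 and $\nabla_{x_i}\psi_i(x,y;\xi)$ exist, $\nabla_{x_i}f_i(x,y)=\mathbb E[\nabla_{x_i}\psi_i(x,y;\xi)]$, and $\nabla_{x_i}f_i(\cdot,y)$ is continuous on $\mathcal R_i$; (b) $\phi(x)=(\nabla_{x_i}f_i(x_i,\bar x))_{i=1}^N$ is $\eta$-strongly monotone ($\eta>0$) and $L$-Lipschitz ($L>0$) on $\mathcal R$, and $\nabla_{x_i}f_i(x,\cdot)$ is $L_i$-Lipschitz on $Y$ for every $x\in\mathcal R_i$ ($L_i\ge 0$); (c) $A=[a_{ij}]$ is a symmetric matrix with row sums one such that, for $i\ne j$, $a_{ij}>0$ if $i,j$ are adjacent in a given connected undirected graph on the players and $a_{ij}=0$ otherwise, and $a_{ii}\ge0$. Let $\theta>0$, $\beta\in(0,1)$ satisfy $|[A^k]_{ij}-1/N|\le\theta\beta^k$ for all $k\ge 0$ and all $i,j$ (such $\theta,\beta$ exist if all $a_{ii}>0$). Let $x^*$ be a Nash equilibrium. **Algorithm:** $v_{i,0}=x_{i,0}\in\mathcal R_i$ (possibly random); with $\tau_k=k+1$, $N_k=\lceil\beta^{-(k+1)/2}\rceil$,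 step size $\alpha\in(0,\eta/L^2)$ and samples $\xi_k^1,\dots,\xi_k^{N_k}$ of $\xi$, $$\hat v_{i,k}=\sum_j[A^{\tau_k}]_{ij}v_{j,k},\qquad x_{i,k+1}=\mathrm{prox}_{\alpha r_i}\Big[x_{i,k}-\frac{\alpha}{N_k}\sum_{p=1}^{N_k}\nabla_{x_i}\psi_i(x_{i,k},N\hat v_{i,k};\xi_k^p)\Big],$$ and either $v_{i,k+1}=v_{i,k}+x_{i,k+1}-x_{i,k}$ for all $i,k$, or $v_{i,k+1}=\hat v_{i,k}+x_{i,k+1}-x_{i,k}$ for all $i,k$. Here $\hat v_{i,k}$ is obtained by $\tau_k$ rounds of communication. With $e_{i,k}=\frac1{N_k}\sum_p\nabla_{x_i}\psi_i(x_{i,k},N\hat v_{i,k};\xi_k^p)-\nabla_{x_i}f_i(x_{i,k},N\hat v_{i,k})$ and $\mathcal F_k=\sigma(x_0,\dots,x_k)$, assume $\mathbb E\|e_{i,k}\|^2<\infty$, $\mathbb E[e_{i,k}\mid\mathcal F_k]=0$ and $\mathbb E[\|e_{i,k}\|^2\mid\mathcal F_k]\le\nu_i^2/N_k$ a.s. Let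 $\mathbb E\|x_0-x^*\|^2\le C$ with $C>0$. **Constants.** $\varrho=1-2\alpha\eta+2\alpha^2L^2$, assumed positive (automatic unless $\mathcal R$ is a single point); $\tilde\varrho\in(\varrho,1)$; $C_1=M\theta\big(1+2e\sqrt{1/\ln(\beta^{-1/2})}\big)$, $C_2=\frac{4M\theta}{\ln(1/\beta)}$, $$C_3=\alpha^2\sum_i\nu_i^2+4\alpha MN(C_1\beta^{1/2}+C_2)\sum_iL_i+4\alpha^2N^2(C_1^2\beta^{3/2}+C_2^2\beta^{1/2})\sum_iL_i^2,$$ $\widetilde C=C+\frac{C_3}{1-\min\{\varrho/\sqrt\beta,\sqrt\beta/\varrho\}}$, $\widetilde D=C+\frac{C_3}{\ln((\tilde\varrho/\varrho)^e)}$, and $$K(\epsilon)=\begin{cases}\frac{\ln(\widetilde C/\epsilon)}{\ln(1/\varrho)},&\beta<\varrho^2,\\ \frac{\ln(\widetilde D/\epsilon)}{\ln(1/\tilde\varrho)},&\beta=\varrho^2,\\ \frac{\ln(\widetilde C/\epsilon)}{\ln(1/\beta^{1/2})},&\varrho<\beta^{1/2},\end{cases}\qquad M(\epsilon)=\frac{m(\epsilon)}{\beta^{1/2}\ln(1/\beta^{1/2})}+K(\epsilon),$$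 where $m(\epsilon)=(\widetilde C/\epsilon)^{\ln(1/\beta^{1/2})/\ln(1/\varrho)}$, $(\widetilde D/\epsilon)^{\ln(1/\varrho)/\ln(1/\tilde\varrho)}$, $\widetilde C/\epsilon$ in the three cases. Let $\delta=\frac{\ln(\varrho/\beta^{1/2})}{\ln(1/\varrho)}$, $\frac{\ln(\tilde\varrho/\varrho)}{\ln(1/\tilde\varrho)}$, $0$ in the three cases. **Theorem.** For every $\epsilon>0$, $\mathbb E\|x_k-x^*\|^2\le\epsilon$ for all integers $k\ge\max\{K(\epsilon),0\}$. Hence the number $k(\epsilon)$ of iterations (proximal evaluations per player) needed to reach an $\epsilon$-NE, i.e. the least $k\ge0$ with $\mathbb E\|x_k-x^*\|^2\le\epsilon$, is at most $\lceil \max\{K(\epsilon),0\}\rceil$. If $K(\epsilon)\ge0$, then the number of communication rounds needed, $\sum_{k<k(\epsilon)}\tau_k$, is at most $\frac{(K(\epsilon)+1)(K(\epsilon)+2)}2$ (and $\sum_{k=0}^{K(\epsilon)}\tau_k$ equals this number if $K(\epsilon)$ is an integer), and the number of sampled gradients needed, $\sum_{k<k(\epsilon)}N_k$, is at most $M(\epsilon)$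 if $K(\epsilon)$ is an integer, and at most $M(\epsilon)$ plus the one batch $N_{\lfloor K(\epsilon)\rfloor}$ in general. As $\epsilon\downarrow0$: $K(\epsilon)$ and the number of proximal evaluations are $O(\ln(1/\epsilon))$; $\frac{(K(\epsilon)+1)(K(\epsilon)+2)}2$ and the number of communication rounds are $O(\ln^2(1/\epsilon))$; $\delta\ge0$, and $M(\epsilon)$ and the number of sampled gradients are $O((1/\epsilon)^{1+\delta})$. -/

import Mathlib

open MeasureTheory Filter Topology Asymptotics

noncomputable section

namespace AggNash

/-- `ℝⁿ` with the Euclidean norm. -/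
abbrev Vec (n : ℕ) : Type := EuclideanSpace ℝ (Fin n)

/-- Data of a stochastic aggregative game with `N` players, strategies in `ℝᵐ` and a random
parameter in `ℝᵈ`.  The nonsmooth term of player `i` is the extended-valued function equal to
`r i` on its effective domain `R i` and to `+∞` elsewhere. -/
structure Game (N m d : ℕ) where
  /-- the law of the random vector `ξ` -/
  law : Measure (Vec d)
  /-- the sampled cost `ψ_i(x_i, y; ξ)`, where `y` stands for the aggregate -/
  ψ : Fin N → Vec m → Vec m → Vec d → ℝ
  /-- the effective domain of `r_i` -/
  R : Fin N → Set (Vec m)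
  /-- the finite values of `r_i` -/
  r : Fin N → Vec m → ℝ

/-- The gradient with respect to the own decision of a cost `h(x_i, x_i + x̄_{-i})`, as a function
of the decision `x` and of the aggregate `y = x + x̄_{-i}`: here `x̄_{-i} = y - x` is kept fixed. -/
def ownGrad {m : ℕ} (h : Vec m → Vec m → ℝ) (x y : Vec m) : Vec m :=
  gradient (fun t => h t (t + (y - x))) x

/-- The differentiability that gives `ownGrad h x y` its meaning. -/
def OwnDiff {m : ℕ} (h : Vec m → Vec m → ℝ) (x y : Vec m) : Prop :=
  DifferentiableAt ℝ (fun t => h t (t + (y - x))) x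

namespace Game

variable {N m d : ℕ} (G : Game N m d)

/-- The expected cost `f_i(x, y) = 𝔼[ψ_i(x, y; ξ)]`. -/
def f (i : Fin N) (x y : Vec m) : ℝ := ∫ s, G.ψ i x y s ∂G.law

/-- `∇_{x_i} f_i(x, y)`. -/
def gradf (i : Fin N) (x y : Vec m) : Vec m := ownGrad (G.f i) x y

/-- `∇_{x_i} ψ_i(x, y; s)`. -/
def gradψ (i : Fin N) (x y : Vec m) (s : Vec d) : Vec m := ownGrad (fun a b => G.ψ i a b s) x y

/-- The set `ℛ` of strategy profiles. -/
def profiles : Set (Fin N → Vec m) := {x | ∀ i, x i ∈ G.R i}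

/-- The set `ℛ̄ = ∑ᵢ ℛᵢ` of aggregates. -/
def aggregates : Set (Vec m) := {y | ∃ x ∈ G.profiles, y = ∑ i, x i}

/-- The aggregate of all players' decisions except that of player `i`. -/
def others (x : Fin N → Vec m) (i : Fin N) : Vec m := ∑ j ∈ Finset.univ.erase i, x j

/-- The cost of player `i` at the decision `t ∈ ℛᵢ` when the rivals play according to `x`. -/
def cost (i : Fin N) (t : Vec m) (x : Fin N → Vec m) : ℝ :=
  G.f i t (t + others x i) + G.r i t

/-- Nash equilibrium (outside `ℛᵢ` the cost of player `i` is `+∞`). -/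
def IsNash (x : Fin N → Vec m) : Prop :=
  ∀ i, x i ∈ G.R i ∧ ∀ t ∈ G.R i, G.cost i (x i) x ≤ G.cost i t x

/-- The gradient map `φ`. -/
def φ (x : Fin N → Vec m) (i : Fin N) : Vec m := G.gradf i (x i) (∑ j, x j)

/-- `M = ∑ⱼ max_{x ∈ ℛⱼ} ‖x‖`. -/
def M : ℝ := ∑ j, sSup ((fun x : Vec m => ‖x‖) '' G.R j)

/-- Standing assumptions on the game.  `Y` is the set of aggregates (and of estimates of the
aggregate) at which gradients are evaluated. -/
structure Regular (Y : Set (Vec m)) : Prop where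
  law_prob : IsProbabilityMeasure G.law
  compact : ∀ i, IsCompact (G.R i)
  convex : ∀ i, ConvexOn ℝ (G.R i) (G.r i)
  lsc : ∀ i, LowerSemicontinuousOn (G.r i) (G.R i)
  subset : G.aggregates ⊆ Y
  /-- the smooth part of the own cost is `C¹` and convex near `ℛᵢ` for all decisions of the
  rivals -/
  smooth : ∀ i, ∀ x ∈ G.profiles, ∃ U : Set (Vec m), IsOpen U ∧ G.R i ⊆ U ∧
    (∀ t ∈ U, Integrable (G.ψ i t (t + others x i)) G.law) ∧
    ConvexOn ℝ U (fun t => G.f i t (t + others x i)) ∧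
    ContDiffOn ℝ 1 (fun t => G.f i t (t + others x i)) U
  /-- `∇_{x_i} f_i(·, y)` exists and is continuous on `ℛᵢ` -/
  f_integrable : ∀ i, ∀ x ∈ G.R i, ∀ y ∈ Y,
    ∀ᶠ t in 𝓝 x, Integrable (G.ψ i t (t + (y - x))) G.law
  f_diff : ∀ i, ∀ x ∈ G.R i, ∀ y ∈ Y, OwnDiff (G.f i) x y
  gradf_cont : ∀ i, ∀ y ∈ Y, ContinuousOn (fun x => G.gradf i x y) (G.R i)
  /-- sampled costs are differentiable, with sampled gradients of mean `∇_{x_i} f_i` -/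
  ψ_diff : ∀ i, ∀ x ∈ G.R i, ∀ y ∈ Y, ∀ s, OwnDiff (fun a b => G.ψ i a b s) x y
  gradψ_integrable : ∀ i, ∀ x ∈ G.R i, ∀ y ∈ Y, Integrable (G.gradψ i x y) G.law
  gradf_eq : ∀ i, ∀ x ∈ G.R i, ∀ y ∈ Y, G.gradf i x y = ∫ s, G.gradψ i x y s ∂G.law

/-- `φ` is strongly monotone over `ℛ` with parameter `η`. -/
def StronglyMonotone (η : ℝ) : Prop :=
  ∀ x ∈ G.profiles, ∀ y ∈ G.profiles,
    η * ∑ i, ‖x i - y i‖ ^ 2 ≤ ∑ i, inner ℝ (G.φ x i - G.φ y i) (x i - y i)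

/-- `φ` is Lipschitz continuous over `ℛ` with constant `L`. -/
def LipschitzMap (L : ℝ) : Prop :=
  ∀ x ∈ G.profiles, ∀ y ∈ G.profiles,
    Real.sqrt (∑ i, ‖G.φ x i - G.φ y i‖ ^ 2) ≤ L * Real.sqrt (∑ i, ‖x i - y i‖ ^ 2)

/-- `∇_{x_i} f_i(x_i, ·)` is Lipschitz continuous over `Y` with constant `ℓ i`. -/
def LipschitzAgg (Y : Set (Vec m)) (ℓ : Fin N → ℝ) : Prop :=
  ∀ i, ∀ x ∈ G.R i, ∀ y₁ ∈ Y, ∀ y₂ ∈ Y, ‖G.gradf i x y₁ - G.gradf i x y₂‖ ≤ ℓ i * ‖y₁ - y₂‖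

end Game

/-- `A` is a symmetric weight matrix with unit row sums adapted to the connected undirected graph
`𝒢` of distinct communicating players; the self-weights `A i i ≥ 0` are free. -/
structure IsWeightMatrix {N : ℕ} (𝒢 : SimpleGraph (Fin N)) (A : Matrix (Fin N) (Fin N) ℝ) :
    Prop where
  connected : 𝒢.Connected
  symm : A.IsSymm
  row_sum : ∀ i, ∑ j, A i j = 1
  diag_nonneg : ∀ i, 0 ≤ A i i
  pos_of_adj : ∀ i j, 𝒢.Adj i j → 0 < A i j
  zero_of_not_adj : ∀ i j, i ≠ j → ¬ 𝒢.Adj i j → A i j = 0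

/-- `θ > 0` and `β ∈ (0,1)` are constants of geometric mixing of the powers of `A`. -/
def Mixing {N : ℕ} (A : Matrix (Fin N) (Fin N) ℝ) (θ β : ℝ) : Prop :=
  0 < θ ∧ 0 < β ∧ β < 1 ∧ ∀ (k : ℕ) (i j : Fin N), |(A ^ k) i j - 1 / (N : ℝ)| ≤ θ * β ^ k

/-- One round of communication. -/
def consensusStep {N m : ℕ} (A : Matrix (Fin N) (Fin N) ℝ) (v : Fin N → Vec m) :
    Fin N → Vec m :=
  fun i => ∑ j, A i j • v j

/-- `p` is the value at `w` of the proximal operator of `α r`, where `r` has effective domain `R`: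
`p` minimizes `r(y) + ‖y - w‖² / (2α)`. -/
def IsProx {m : ℕ} (α : ℝ) (R : Set (Vec m)) (r : Vec m → ℝ) (w p : Vec m) : Prop :=
  p ∈ R ∧ ∀ y ∈ R, r p + 1 / (2 * α) * ‖p - w‖ ^ 2 ≤ r y + 1 / (2 * α) * ‖y - w‖ ^ 2

section Algorithm

variable {N m d : ℕ} {Ω : Type*} [MeasurableSpace Ω]

/-- The estimates `v̂_{i,k}` after `τ` rounds of communication started from `v`. -/
def consensus (A : Matrix (Fin N) (Fin N) ℝ) (τ : ℕ) (v : Fin N → Vec m) : Fin N → Vec m :=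
  (consensusStep A)^[τ] v

/-- The average of the `n` sampled gradients of player `i` at decision `x` and aggregate `y`. -/
def sampleGrad (G : Game N m d) (i : Fin N) (x y : Vec m) (n : ℕ) (s : ℕ → Vec d) : Vec m :=
  (n : ℝ)⁻¹ • ∑ p ∈ Finset.range n, G.gradψ i x y (s p)

/-- A run of the distributed variable sample-size proximal gradient-response scheme with step size
`α`, `τ k` rounds of communication and `n k` samples in iteration `k`. -/
structure Run (G : Game N m d) (A : Matrix (Fin N) (Fin N) ℝ) (α : ℝ) (τ n : ℕ → ℕ)
    (Y : Set (Vec m)) (P : Measure Ω) where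
  /-- strategies -/
  x : ℕ → Ω → Fin N → Vec m
  /-- estimates of the average -/
  v : ℕ → Ω → Fin N → Vec m
  /-- samples -/
  ξ : ℕ → ℕ → Ω → Vec d
  x_meas : ∀ k, Measurable (x k)
  ξ_meas : ∀ k p, p < n k → Measurable (ξ k p)
  ξ_law : ∀ k p, p < n k → P.map (ξ k p) = G.law
  x_zero : ∀ ω, x 0 ω ∈ G.profiles
  v_zero : ∀ ω, v 0 ω = x 0 ω
  /-- gradients are evaluated at estimates of the aggregate in `Y` only -/
  mem_Y : ∀ k ω i, (N : ℝ) • consensus A (τ k) (v k ω) i ∈ Y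
  x_succ : ∀ k ω i, IsProx α (G.R i) (G.r i)
    (x k ω i - α • sampleGrad G i (x k ω i) ((N : ℝ) • consensus A (τ k) (v k ω) i) (n k)
      (fun p => ξ k p ω)) (x (k + 1) ω i)
  /-- the new estimate of the average corrects either the estimate before the communication rounds
  or the one after them -/
  v_succ : (∀ k ω i, v (k + 1) ω i = v k ω i + x (k + 1) ω i - x k ω i) ∨
    (∀ k ω i, v (k + 1) ω i = consensus A (τ k) (v k ω) i + x (k + 1) ω i - x k ω i)

namespace Run

variable {G : Game N m d} {A : Matrix (Fin N) (Fin N) ℝ} {α : ℝ} {τ n : ℕ → ℕ}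
  {Y : Set (Vec m)} {P : Measure Ω} (S : Run G A α τ n Y P)

/-- The gradient error `e_{i,k}`. -/
def e (k : ℕ) (i : Fin N) (ω : Ω) : Vec m :=
  sampleGrad G i (S.x k ω i) ((N : ℝ) • consensus A (τ k) (S.v k ω) i) (n k)
      (fun p => S.ξ k p ω) -
    G.gradf i (S.x k ω i) ((N : ℝ) • consensus A (τ k) (S.v k ω) i)

/-- The `σ`-algebra generated by `x_0, …, x_k`. -/
@[reducible] def 𝓕 (k : ℕ) : MeasurableSpace Ω :=
  ⨆ j ∈ Finset.range (k + 1), MeasurableSpace.comap (S.x j) inferInstance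

/-- Conditionally unbiased gradient errors with conditional second moments at most
`ν_i² / N_k`. -/
structure Noise (ν : Fin N → ℝ) : Prop where
  memLp : ∀ k i, MemLp (S.e k i) 2 P
  mean : ∀ k i, P[S.e k i | S.𝓕 k] =ᵐ[P] 0
  second_moment : ∀ k i,
    P[fun ω => ‖S.e k i ω‖ ^ 2 | S.𝓕 k] ≤ᵐ[P] fun _ => ν i ^ 2 / (n k : ℝ)

/-- The mean-squared error `𝔼‖x_k - x*‖²`. -/
def mse (xs : Fin N → Vec m) (k : ℕ) : ℝ := ∫ ω, ∑ i, ‖S.x k ω i - xs i‖ ^ 2 ∂P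

/-- The number of iterations (proximal evaluations per player) needed to get an `ε`-NE. -/
def iters (xs : Fin N → Vec m) (ε : ℝ) : ℕ := sInf {k | S.mse xs k ≤ ε}

/-- The number of communication rounds needed to get an `ε`-NE. -/
def rounds (xs : Fin N → Vec m) (ε : ℝ) : ℕ := ∑ k ∈ Finset.range (S.iters xs ε), τ k

/-- The number of sampled gradients (per player) needed to get an `ε`-NE. -/
def samples (xs : Fin N → Vec m) (ε : ℝ) : ℕ := ∑ k ∈ Finset.range (S.iters xs ε), n k

end Run

end Algorithm

/-! Parameters and constants -/

/-- `τ_k = k + 1`. -/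
def tau (k : ℕ) : ℕ := k + 1

/-- `N_k = ⌈β^{-(k+1)/2}⌉`. -/
def batch (β : ℝ) (k : ℕ) : ℕ := ⌈β ^ (-((k : ℝ) + 1) / 2)⌉₊

/-- `ϱ = 1 - 2αη + 2α²L²`. -/
def rate (α η L : ℝ) : ℝ := 1 - 2 * α * η + 2 * α ^ 2 * L ^ 2

def C₁ (M θ β : ℝ) : ℝ :=
  M * θ * (1 + 2 * Real.exp 1 * Real.sqrt (1 / Real.log (β ^ (-(1 / 2) : ℝ))))

def C₂ (M θ β : ℝ) : ℝ := 4 * M * θ / Real.log (1 / β)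

def C₃ {N : ℕ} (M θ β α : ℝ) (ℓ ν : Fin N → ℝ) : ℝ :=
  α ^ 2 * ∑ i, ν i ^ 2 +
  4 * α * M * N * (C₁ M θ β * β ^ (1 / 2 : ℝ) + C₂ M θ β) * ∑ i, ℓ i +
  4 * α ^ 2 * (N : ℝ) ^ 2 *
    (C₁ M θ β ^ 2 * β ^ (3 / 2 : ℝ) + C₂ M θ β ^ 2 * β ^ (1 / 2 : ℝ)) * ∑ i, ℓ i ^ 2

/-- `C̃(ϱ, β)`. -/
def Ctil (C c₃ ϱ β : ℝ) : ℝ :=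
  C + c₃ / (1 - min (ϱ / Real.sqrt β) (Real.sqrt β / ϱ))

/-- `D̃(ϱ)`. -/
def Dtil (C c₃ ϱ ϱt : ℝ) : ℝ := C + c₃ / Real.log ((ϱt / ϱ) ^ Real.exp 1)

/-- `K(ε)`; the last case is `ϱ < β^{1/2} < 1`. -/
def K (C c₃ ϱ ϱt β ε : ℝ) : ℝ :=
  if β < ϱ ^ 2 then 1 / Real.log (1 / ϱ) * Real.log (Ctil C c₃ ϱ β / ε)
  else if β = ϱ ^ 2 then 1 / Real.log (1 / ϱt) * Real.log (Dtil C c₃ ϱ ϱt / ε)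
  else 1 / Real.log (1 / β ^ (1 / 2 : ℝ)) * Real.log (Ctil C c₃ ϱ β / ε)

/-- `M(ε)`; the last case is `ϱ < β^{1/2} < 1`. -/
def Msamp (C c₃ ϱ ϱt β ε : ℝ) : ℝ :=
  (if β < ϱ ^ 2 then
    (Ctil C c₃ ϱ β / ε) ^ (Real.log (1 / β ^ (1 / 2 : ℝ)) / Real.log (1 / ϱ))
  else if β = ϱ ^ 2 then
    (Dtil C c₃ ϱ ϱt / ε) ^ (Real.log (1 / ϱ) / Real.log (1 / ϱt))
  else Ctil C c₃ ϱ β / ε) / (β ^ (1 / 2 : ℝ) * Real.log (1 / β ^ (1 / 2 : ℝ))) +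
  K C c₃ ϱ ϱt β ε

/-- The exponent `δ` in `O((1/ε)^{1+δ})`; the last case is `ϱ < β^{1/2} < 1`. -/
def delta (ϱ ϱt β : ℝ) : ℝ :=
  if β < ϱ ^ 2 then Real.log (ϱ / β ^ (1 / 2 : ℝ)) / Real.log (1 / ϱ)
  else if β = ϱ ^ 2 then Real.log (ϱt / ϱ) / Real.log (1 / ϱt)
  else 0

end AggNash

end

/-!
The mean-squared error satisfies a linear recursion with a geometrically decaying perturbation.
Write `q = β ^ (1 / 2)`.

A Nash equilibrium `x*` satisfies a variational inequality (`Game.IsNash.inner_nonneg`), so it is a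
fixed point of the exact proximal gradient map. Since proximal points depend nonexpansively on their
base points, one iteration is bounded by the forward step `x - α (g + e)` compared with
`x* - α φ(x*)` (`Game.IsNash.norm_prox_sub_le`). Strong monotonicity and Lipschitz continuity of `φ`
contract the noiseless forward step by `ϱ = 1 - 2 α η + 2 α² L²`, up to the error made by evaluating
gradients at estimated aggregates (`Game.forward_step_le`). The estimates, hence the exact
gradients at them, are functions of the past decisions, so the conditionally centred error `e`
contributes only its second moment, at most `ν² / N_k ≤ ν² q ^ (k + 1)` (`Run.mse_succ_le`).

The `k + 1` rounds of communication reduce the consensus error to order `(1 + 2 k) β ^ (k + 1)`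
(`norm_consensus_sub_average_le`). The factor `k` is absorbed by half of the decay, since
`k q ^ k ≤ 1 / (e log (1 / q))`, which leaves a bound of order `q ^ (k + 1)`
(`consensus_rate_le`). Altogether `u (k + 1) ≤ ϱ u k + C₃ q ^ (k + 1)`
(`Run.mse_succ_le_geometric`), and comparing `q` with `ϱ` gives `u k ≤ D r ^ k` with `r = ϱ`, `ϱt`
or `q` in the three regimes (`exists_geometric_decay`).

Everything else is counting (`Run.complexity`): `D r ^ k ≤ ε` once `k ≥ K(ε)`, the numbers of rounds
add up to a triangular number, and the batches to a geometric sum, for which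
`(1 / q) ^ K(ε) = (D / ε) ^ (1 + δ)`.

The existence of mixing constants rests on the contraction of deviations by a doubly stochastic
matrix with positive entries (`abs_pow_sub_le`), applied to a power of `A`.
-/

namespace AggNash

/-! ### Geometric mixing of weight matrices -/

lemma IsWeightMatrix.mem_doublyStochastic {N : ℕ} {𝒢 : SimpleGraph (Fin N)}
    {A : Matrix (Fin N) (Fin N) ℝ} (hA : IsWeightMatrix 𝒢 A) : A ∈ doublyStochastic ℝ (Fin N) := by
  rw [mem_doublyStochastic_iff_sum]
  refine ⟨fun i j => ?_, hA.row_sum, fun j => ?_⟩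
  · by_cases hij : i = j
    · subst hij; exact hA.diag_nonneg i
    · by_cases h : 𝒢.Adj i j
      · exact (hA.pos_of_adj i j h).le
      · exact (hA.zero_of_not_adj i j hij h).ge
  · rw [← hA.row_sum j]
    exact Finset.sum_congr rfl fun i _ => hA.symm.apply j i

section DoublyStochastic

variable {N : ℕ} {A : Matrix (Fin N) (Fin N) ℝ}

lemma pow_entry_nonneg (hA : A ∈ doublyStochastic ℝ (Fin N)) (k : ℕ) (i j : Fin N) :
    0 ≤ (A ^ k) i j :=
  (mem_doublyStochastic_iff_sum.1 (pow_mem hA k)).1 i j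

lemma pow_row_sum (hA : A ∈ doublyStochastic ℝ (Fin N)) (k : ℕ) (i : Fin N) :
    ∑ j, (A ^ k) i j = 1 :=
  (mem_doublyStochastic_iff_sum.1 (pow_mem hA k)).2.1 i

lemma pow_col_sum (hA : A ∈ doublyStochastic ℝ (Fin N)) (k : ℕ) (j : Fin N) :
    ∑ i, (A ^ k) i j = 1 :=
  (mem_doublyStochastic_iff_sum.1 (pow_mem hA k)).2.2 j

lemma mul_le_pow_succ_entry (hA : A ∈ doublyStochastic ℝ (Fin N)) (k : ℕ) (i l j : Fin N) :
    A i l * (A ^ k) l j ≤ (A ^ (k + 1)) i j := by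
  rw [pow_succ', Matrix.mul_apply]
  exact Finset.single_le_sum (f := fun l => A i l * (A ^ k) l j)
    (fun l _ => mul_nonneg ((mem_doublyStochastic_iff_sum.1 hA).1 i l) (pow_entry_nonneg hA k l j))
    (Finset.mem_univ l)

/-- If every entry of a doubly stochastic matrix is at least `c`, then each further factor
contracts the deviation from uniform averaging by `1 - N c`: subtracting the constant `c` from a row
does not change its product with a column of deviations, as these sum to zero. -/
lemma abs_pow_sub_le (hN : 0 < N) (hA : A ∈ doublyStochastic ℝ (Fin N)) {c : ℝ}
    (hc : ∀ i j, c ≤ A i j) (n : ℕ) (i j : Fin N) :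
    |(A ^ n) i j - 1 / (N : ℝ)| ≤ (1 - N * c) ^ n := by
  have hN' : (0 : ℝ) < N := by exact_mod_cast hN
  induction n generalizing i with
  | zero =>
    have h1 : (1 : ℝ) / N ≤ 1 := by
      rw [div_le_one hN']; exact_mod_cast hN
    have h0 : (0 : ℝ) ≤ 1 / N := by positivity
    rw [pow_zero, pow_zero, Matrix.one_apply, abs_le]
    split_ifs <;> constructor <;> linarith
  | succ n ih =>
    have hsum : ∑ l, ((A ^ n) l j - 1 / (N : ℝ)) = 0 := by
      rw [Finset.sum_sub_distrib, pow_col_sum hA]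
      simp [hN'.ne']
    have hrow : ∑ l, A i l = 1 := by simpa using pow_row_sum hA 1 i
    have key : (A ^ (n + 1)) i j - 1 / (N : ℝ)
        = ∑ l, (A i l - c) * ((A ^ n) l j - 1 / (N : ℝ)) := by
      simp_rw [sub_mul (A i _) c]
      rw [Finset.sum_sub_distrib, ← Finset.mul_sum, hsum, mul_zero, sub_zero]
      simp_rw [mul_sub]
      rw [Finset.sum_sub_distrib, ← Finset.sum_mul, hrow, one_mul, pow_succ', Matrix.mul_apply]
    rw [key]
    calc |∑ l, (A i l - c) * ((A ^ n) l j - 1 / (N : ℝ))|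
        ≤ ∑ l, |(A i l - c) * ((A ^ n) l j - 1 / (N : ℝ))| := Finset.abs_sum_le_sum_abs _ _
      _ ≤ ∑ l, (A i l - c) * (1 - N * c) ^ n := by
          refine Finset.sum_le_sum fun l _ => ?_
          rw [abs_mul, abs_of_nonneg (sub_nonneg.2 (hc i l))]
          exact mul_le_mul_of_nonneg_left (ih l) (sub_nonneg.2 (hc i l))
      _ = (1 - N * c) ^ (n + 1) := by
          rw [← Finset.sum_mul, Finset.sum_sub_distrib, hrow]
          simp [pow_succ']

end DoublyStochastic

/-- Walks of the graph, padded by self-loops, make all high powers of the matrix positive. -/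
lemma IsWeightMatrix.exists_pow_pos {N : ℕ} {𝒢 : SimpleGraph (Fin N)}
    {A : Matrix (Fin N) (Fin N) ℝ} (hA : IsWeightMatrix 𝒢 A) (hdiag : ∀ i, 0 < A i i) :
    ∃ q : ℕ, 0 < q ∧ ∀ i j, 0 < (A ^ q) i j := by
  have hD := hA.mem_doublyStochastic
  have walk : ∀ i j, 𝒢.Walk i j → ∃ n : ℕ, ∀ k, n ≤ k → 0 < (A ^ k) i j := by
    intro i j w
    induction w with
    | nil =>
      refine ⟨0, fun k _ => ?_⟩
      induction k with
      | zero => simp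
      | succ k ih => exact (mul_pos (hdiag _) (ih (Nat.zero_le k))).trans_le (mul_le_pow_succ_entry hD k _ _ _)
    | cons hadj _ ih =>
      obtain ⟨n, hn⟩ := ih
      refine ⟨n + 1, fun k hk => ?_⟩
      obtain ⟨k, rfl⟩ : ∃ l, k = l + 1 := ⟨k - 1, by omega⟩
      exact (mul_pos (hA.pos_of_adj _ _ hadj) (hn k (by omega))).trans_le
        (mul_le_pow_succ_entry hD k _ _ _)
  choose n hn using fun i j => walk i j (hA.connected.preconnected i j).some
  refine ⟨(Finset.univ.sup fun i => Finset.univ.sup (n i)) + 1, Nat.succ_pos _, fun i j => ?_⟩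
  refine hn i j _ (le_trans ?_ (Nat.le_succ _))
  exact (Finset.le_sup (f := n i) (Finset.mem_univ j)).trans
    (Finset.le_sup (f := fun i => Finset.univ.sup (n i)) (Finset.mem_univ i))

/-- Geometric mixing of the powers of a weight matrix with positive self-weights. -/
theorem IsWeightMatrix.exists_mixing {N : ℕ} {𝒢 : SimpleGraph (Fin N)}
    {A : Matrix (Fin N) (Fin N) ℝ} (hA : IsWeightMatrix 𝒢 A) (hdiag : ∀ i, 0 < A i i) :
    ∃ θ β : ℝ, Mixing A θ β := by
  have hD := hA.mem_doublyStochastic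
  have : Nonempty (Fin N) := hA.connected.nonempty
  have hN : 0 < N := Fin.pos_iff_nonempty.2 this
  have hN' : (0 : ℝ) < N := by exact_mod_cast hN
  obtain ⟨q, hq, hpos⟩ := hA.exists_pow_pos hdiag
  obtain ⟨a, ha⟩ := Finite.exists_min fun p : Fin N × Fin N => (A ^ q) p.1 p.2
  -- the factor `1 - N c` has to be positive as well, hence the second term of the minimum
  set c : ℝ := min ((A ^ q) a.1 a.2) (1 / (2 * N)) with hc
  have hc0 : 0 < c := lt_min (hpos _ _) (by positivity)
  have hcN : N * c ≤ 1 / 2 := by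
    calc N * c ≤ N * (1 / (2 * N)) := mul_le_mul_of_nonneg_left (min_le_right _ _) hN'.le
      _ = 1 / 2 := by field_simp
  set ρ : ℝ := 1 - N * c with hρ
  have hρ0 : 0 < ρ := by linarith
  have hρ1 : ρ < 1 := by have := mul_pos hN' hc0; linarith
  have hq' : (0 : ℝ) < q := by exact_mod_cast hq
  set β : ℝ := ρ ^ (1 / (q : ℝ)) with hβ
  have hβ0 : 0 < β := Real.rpow_pos_of_pos hρ0 _
  have hβ1 : β < 1 := Real.rpow_lt_one hρ0.le hρ1 (by positivity)
  have hβq : β ^ q = ρ := by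
    rw [hβ, one_div, Real.rpow_inv_natCast_pow hρ0.le hq.ne']
  refine ⟨ρ⁻¹, β, inv_pos.2 hρ0, hβ0, hβ1, fun k i j => ?_⟩
  have hpow : ∀ n i j, |((A ^ q) ^ n) i j - 1 / (N : ℝ)| ≤ ρ ^ n := fun n i j =>
    abs_pow_sub_le hN (pow_mem hD q)
      (fun i j => (min_le_left _ _).trans (ha (i, j))) n i j
  have hk : A ^ k = A ^ (k % q) * (A ^ q) ^ (k / q) := by
    rw [← pow_mul, ← pow_add, Nat.mod_add_div]
  have hdev : (A ^ k) i j - 1 / (N : ℝ)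
      = ∑ l, (A ^ (k % q)) i l * (((A ^ q) ^ (k / q)) l j - 1 / (N : ℝ)) := by
    simp_rw [mul_sub]
    rw [Finset.sum_sub_distrib, ← Finset.sum_mul, pow_row_sum hD, one_mul, hk, Matrix.mul_apply]
  calc |(A ^ k) i j - 1 / (N : ℝ)|
      ≤ ∑ l, |(A ^ (k % q)) i l * (((A ^ q) ^ (k / q)) l j - 1 / (N : ℝ))| := by
        rw [hdev]; exact Finset.abs_sum_le_sum_abs _ _
    _ ≤ ∑ l, (A ^ (k % q)) i l * ρ ^ (k / q) := by
        refine Finset.sum_le_sum fun l _ => ?_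
        rw [abs_mul, abs_of_nonneg (pow_entry_nonneg hD _ i l)]
        exact mul_le_mul_of_nonneg_left (hpow _ l j) (pow_entry_nonneg hD _ i l)
    _ = ρ⁻¹ * (ρ ^ (k / q) * β ^ q) := by
        rw [← Finset.sum_mul, pow_row_sum hD, hβq]
        field_simp
    _ ≤ ρ⁻¹ * (ρ ^ (k / q) * β ^ (k % q)) := by
        have := pow_le_pow_of_le_one hβ0.le hβ1.le (Nat.mod_lt k hq).le
        gcongr
    _ = ρ⁻¹ * β ^ k := by
        rw [← hβq, ← pow_mul, ← pow_add, Nat.div_add_mod]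

/-! ### Consensus error -/

section Consensus

variable {N m : ℕ} {A : Matrix (Fin N) (Fin N) ℝ}

lemma consensus_apply (A : Matrix (Fin N) (Fin N) ℝ) (t : ℕ) (z : Fin N → Vec m) (i : Fin N) :
    consensus A t z i = ∑ j, (A ^ t) i j • z j := by
  induction t generalizing i with
  | zero => simp [consensus, Matrix.one_apply]
  | succ t ih =>
    have h : consensus A (t + 1) z i = ∑ l, A i l • consensus A t z l := by
      simp only [consensus, Function.iterate_succ_apply']
      rfl
    simp_rw [h, ih, pow_succ', Matrix.mul_apply, Finset.sum_smul, Finset.smul_sum, smul_smul]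
    exact Finset.sum_comm

lemma consensus_add (A : Matrix (Fin N) (Fin N) ℝ) (t : ℕ) (z w : Fin N → Vec m) (i : Fin N) :
    consensus A t (fun j => z j + w j) i = consensus A t z i + consensus A t w i := by
  simp_rw [consensus_apply, smul_add, Finset.sum_add_distrib]

lemma consensus_consensus (A : Matrix (Fin N) (Fin N) ℝ) (s t : ℕ) (z : Fin N → Vec m) :
    consensus A s (consensus A t z) = consensus A (s + t) z := by
  simp only [consensus, Function.iterate_add_apply]

lemma norm_consensus_sub_le {θ β : ℝ} (hmix : Mixing A θ β) (t : ℕ) (z : Fin N → Vec m)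
    (i : Fin N) :
    ‖consensus A t z i - (N : ℝ)⁻¹ • ∑ j, z j‖ ≤ θ * β ^ t * ∑ j, ‖z j‖ := by
  rw [consensus_apply, Finset.smul_sum, ← Finset.sum_sub_distrib, Finset.mul_sum]
  refine norm_sum_le_of_le _ fun j _ => ?_
  rw [← sub_smul, norm_smul, Real.norm_eq_abs, ← one_div]
  exact mul_le_mul_of_nonneg_right (hmix.2.2.2 t i j) (norm_nonneg _)

/-- Error of the estimates of the average after `t` further rounds of communication, for both
variants of the correction step.  Each iteration adds at most the change `2 M` of the decisions,
damped by the same rounds; the damping by earlier rounds is not needed. -/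
lemma norm_consensus_sub_average_le {θ β M : ℝ} (hmix : Mixing A θ β)
    {τ : ℕ → ℕ} {x v : ℕ → Fin N → Vec m} (hx : ∀ k, ∑ j, ‖x k j‖ ≤ M) (h0 : v 0 = x 0)
    (hv : (∀ k i, v (k + 1) i = v k i + x (k + 1) i - x k i) ∨
      (∀ k i, v (k + 1) i = consensus A (τ k) (v k) i + x (k + 1) i - x k i))
    (k t : ℕ) (i : Fin N) :
    ‖consensus A t (v k) i - (N : ℝ)⁻¹ • ∑ j, x k j‖ ≤ M * θ * (1 + 2 * k) * β ^ t := by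
  have hθ : 0 < θ := hmix.1
  have hβ : 0 < β := hmix.2.1
  have hβ1 : β < 1 := hmix.2.2.1
  have hM : 0 ≤ M := (Finset.sum_nonneg fun j _ => norm_nonneg _).trans (hx 0)
  have hP : ∀ t, 0 ≤ θ * β ^ t := fun t => by positivity
  rcases hv with hv | hv
  · have hvx : ∀ k, v k = x k := fun k => by
      induction k with
      | zero => exact h0
      | succ k ih => funext i; rw [hv, ih]; abel
    rw [hvx]
    calc _ ≤ θ * β ^ t * ∑ j, ‖x k j‖ := norm_consensus_sub_le hmix t _ i
      _ ≤ θ * β ^ t * M := mul_le_mul_of_nonneg_left (hx k) (hP t)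
      _ = M * θ * 1 * β ^ t := by ring
      _ ≤ M * θ * (1 + 2 * k) * β ^ t := by gcongr; linarith [k.cast_nonneg (α := ℝ)]
  · induction k generalizing t with
    | zero =>
      rw [h0]
      calc _ ≤ θ * β ^ t * ∑ j, ‖x 0 j‖ := norm_consensus_sub_le hmix t _ i
        _ ≤ θ * β ^ t * M := mul_le_mul_of_nonneg_left (hx 0) (hP t)
        _ = _ := by push_cast; ring
    | succ k ih =>
      have hsplit : v (k + 1) = fun j => consensus A (τ k) (v k) j + (x (k + 1) j - x k j) := by
        funext j; rw [hv]; abel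
      have hdiff : ∑ j, ‖x (k + 1) j - x k j‖ ≤ 2 * M := by
        calc _ ≤ ∑ j, (‖x (k + 1) j‖ + ‖x k j‖) := Finset.sum_le_sum fun j _ => norm_sub_le _ _
          _ ≤ 2 * M := by rw [Finset.sum_add_distrib]; linarith [hx k, hx (k + 1)]
      have heq : consensus A t (v (k + 1)) i - (N : ℝ)⁻¹ • ∑ j, x (k + 1) j
          = (consensus A (t + τ k) (v k) i - (N : ℝ)⁻¹ • ∑ j, x k j)
            + (consensus A t (fun j => x (k + 1) j - x k j) i
              - (N : ℝ)⁻¹ • ∑ j, (x (k + 1) j - x k j)) := by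
        rw [hsplit, consensus_add, consensus_consensus, Finset.sum_sub_distrib, smul_sub]
        abel
      rw [heq]
      have hle : β ^ (t + τ k) ≤ β ^ t :=
        pow_le_pow_of_le_one hβ.le hβ1.le (Nat.le_add_right _ _)
      calc _ ≤ M * θ * (1 + 2 * k) * β ^ (t + τ k) + θ * β ^ t * ∑ j, ‖x (k + 1) j - x k j‖ :=
            norm_add_le_of_le (ih _) (norm_consensus_sub_le hmix t _ i)
        _ ≤ M * θ * (1 + 2 * k) * β ^ t + θ * β ^ t * (2 * M) := by
            gcongr
        _ = _ := by push_cast; ring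

end Consensus

/-- `t q ^ t ≤ 1 / (e log (1 / q))`, the maximum over `t` being attained at `1 / log (1 / q)`. -/
lemma mul_pow_le {q : ℝ} (hq0 : 0 < q) (hq1 : q < 1) (k : ℕ) :
    k * q ^ k ≤ 1 / (Real.exp 1 * Real.log (1 / q)) := by
  have hlog : 0 < Real.log (1 / q) := Real.log_pos (by rw [lt_div_iff₀ hq0]; linarith)
  have h := Real.add_one_le_exp (k * Real.log (1 / q) - 1)
  have hpow : q ^ k = Real.exp (-(k * Real.log (1 / q))) := by
    rw [one_div, Real.log_inv, mul_neg, neg_neg, mul_comm, Real.exp_mul, Real.exp_log hq0,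
      Real.rpow_natCast]
  rw [le_div_iff₀ (by positivity), hpow]
  have h2 : k * Real.log (1 / q) ≤ Real.exp (k * Real.log (1 / q)) / Real.exp 1 := by
    rw [← Real.exp_sub]; linarith
  rw [le_div_iff₀ (Real.exp_pos _)] at h2
  calc _ = (k * Real.log (1 / q) * Real.exp 1) * Real.exp (-(k * Real.log (1 / q))) := by ring
    _ ≤ Real.exp (k * Real.log (1 / q)) * Real.exp (-(k * Real.log (1 / q))) :=
        mul_le_mul_of_nonneg_right h2 (Real.exp_pos _).le
    _ = 1 := by rw [← Real.exp_add]; simp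

lemma C₁_nonneg {M θ β : ℝ} (hM : 0 ≤ M) (hθ : 0 ≤ θ) : 0 ≤ C₁ M θ β := by
  unfold C₁; positivity

lemma C₂_nonneg {M θ β : ℝ} (hM : 0 ≤ M) (hθ : 0 ≤ θ) (hβ0 : 0 < β) (hβ1 : β < 1) :
    0 ≤ C₂ M θ β := by
  have : 0 < Real.log (1 / β) := Real.log_pos (by rw [lt_div_iff₀ hβ0]; linarith)
  unfold C₂; positivity

/-- The consensus error in terms of the constants `C₁` and `C₂`, with `q = β ^ (1 / 2)`. -/
lemma consensus_rate_le {M θ q : ℝ} (hM : 0 ≤ M) (hθ : 0 ≤ θ) (hq0 : 0 < q) (hq1 : q < 1)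
    (k : ℕ) :
    M * θ * (1 + 2 * k) * (q ^ 2) ^ (k + 1) ≤
      C₁ M θ (q ^ 2) * q ^ (k + 2) + C₂ M θ (q ^ 2) * q ^ (k + 1) := by
  have hlog : 0 < Real.log (1 / q) := Real.log_pos (by rw [lt_div_iff₀ hq0]; linarith)
  have h1 : M * θ * (q ^ 2) ^ (k + 1) ≤ C₁ M θ (q ^ 2) * q ^ (k + 2) := by
    have : M * θ ≤ C₁ M θ (q ^ 2) := by
      unfold C₁
      apply le_mul_of_one_le_right (by positivity)
      have : 0 ≤ 2 * Real.exp 1 * Real.sqrt (1 / Real.log ((q ^ 2) ^ (-(1 / 2) : ℝ))) := by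
        positivity
      linarith
    rw [← pow_mul]
    have hC := C₁_nonneg (β := q ^ 2) hM hθ
    have := pow_le_pow_of_le_one hq0.le hq1.le (show k + 2 ≤ 2 * (k + 1) by omega)
    gcongr
  have h2 : M * θ * (2 * k) * (q ^ 2) ^ (k + 1) ≤ C₂ M θ (q ^ 2) * q ^ (k + 1) := by
    have hC : C₂ M θ (q ^ 2) = M * θ * 2 * (1 / Real.log (1 / q)) := by
      have : Real.log (1 / q ^ 2) = 2 * Real.log (1 / q) := by
        rw [← one_div_pow, Real.log_pow]; norm_num
      rw [C₂, this]; field_simp; ring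
    have hk : (k : ℝ) * q ^ (k + 1) ≤ 1 / Real.log (1 / q) := by
      calc (k : ℝ) * q ^ (k + 1) ≤ k * q ^ k := by
            gcongr ?_ * ?_
            exact pow_le_pow_of_le_one hq0.le hq1.le (Nat.le_succ k)
        _ ≤ 1 / (Real.exp 1 * Real.log (1 / q)) := mul_pow_le hq0 hq1 k
        _ ≤ 1 / Real.log (1 / q) := by
            apply one_div_le_one_div_of_le hlog
            have : (1 : ℝ) ≤ Real.exp 1 := Real.one_le_exp (by norm_num)
            nlinarith
    calc M * θ * (2 * k) * (q ^ 2) ^ (k + 1)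
        = M * θ * 2 * (k * q ^ (k + 1)) * q ^ (k + 1) := by ring
      _ ≤ M * θ * 2 * (1 / Real.log (1 / q)) * q ^ (k + 1) := by gcongr
      _ = _ := by rw [hC]
  calc _ = M * θ * (q ^ 2) ^ (k + 1) + M * θ * (2 * k) * (q ^ 2) ^ (k + 1) := by ring
    _ ≤ _ := add_le_add h1 h2

/-! ### Proximal steps and Nash equilibria -/

lemma nonneg_of_forall_mul_add_sq {a b : ℝ}
    (h : ∀ t : ℝ, 0 < t → t ≤ 1 → 0 ≤ t * a + t ^ 2 * b) : 0 ≤ a := by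
  have hlim : Tendsto (fun t : ℝ => a + t * b) (𝓝[>] 0) (𝓝 a) := by
    have : Tendsto (fun t : ℝ => a + t * b) (𝓝 0) (𝓝 (a + 0 * b)) :=
      Continuous.tendsto (by fun_prop) 0
    simpa using this.mono_left nhdsWithin_le_nhds
  refine ge_of_tendsto hlim ?_
  filter_upwards [Ioc_mem_nhdsGT (zero_lt_one' ℝ)] with t ht
  have := h t ht.1 ht.2
  exact nonneg_of_mul_nonneg_right (by nlinarith : 0 ≤ t * (a + t * b)) ht.1

/-- First-order optimality condition of a proximal point. -/
lemma IsProx.inner_le {m : ℕ} {α : ℝ} (hα : 0 < α) {R : Set (Vec m)} {r : Vec m → ℝ}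
    (hr : ConvexOn ℝ R r) {w p : Vec m} (hp : IsProx α R r w p) {y : Vec m} (hy : y ∈ R) :
    inner ℝ (w - p) (y - p) ≤ α * (r y - r p) := by
  have key : 0 ≤ (r y - r p) + 1 / α * inner ℝ (p - w) (y - p) := by
    refine nonneg_of_forall_mul_add_sq (b := 1 / (2 * α) * ‖y - p‖ ^ 2) fun t ht0 ht1 => ?_
    have hconv := hr.2 hp.1 hy (sub_nonneg.2 ht1) ht0.le (by ring)
    have hmem := hr.1 hp.1 hy (sub_nonneg.2 ht1) ht0.le (by ring)
    have hmin := hp.2 _ hmem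
    have heq : (1 - t) • p + t • y - w = (p - w) + t • (y - p) := by module
    rw [heq, norm_add_sq_real, inner_smul_right, norm_smul, mul_pow, Real.norm_eq_abs, sq_abs]
      at hmin
    simp only [smul_eq_mul] at hconv
    have : 1 / (2 * α) * (2 * (t * inner ℝ (p - w) (y - p)))
        = t * (1 / α * inner ℝ (p - w) (y - p)) := by
      field_simp
    nlinarith
  have h2 : inner ℝ (w - p) (y - p) = - inner ℝ (p - w) (y - p) := by
    rw [← inner_neg_left, neg_sub]
  have h3 : α * (1 / α * inner ℝ (p - w) (y - p)) = inner ℝ (p - w) (y - p) := by field_simp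
  nlinarith [mul_nonneg hα.le key]

/-- Proximal points depend nonexpansively on their base points, here in terms of their
optimality conditions. -/
lemma norm_sub_le_of_inner_le {E : Type*} [NormedAddCommGroup E] [InnerProductSpace ℝ E]
    {w w' p p' : E} {c : ℝ} (h : inner ℝ (w - p) (p' - p) ≤ c)
    (h' : inner ℝ (w' - p') (p - p') ≤ -c) : ‖p - p'‖ ≤ ‖w - w'‖ := by
  have hsum : inner ℝ (w - p) (p' - p) + inner ℝ (w' - p') (p - p')
      = ‖p - p'‖ ^ 2 - inner ℝ (w - w') (p - p') := by
    rw [← real_inner_self_eq_norm_sq, ← inner_sub_left, ← neg_sub p p', inner_neg_right,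
      ← inner_neg_left, ← inner_add_left]
    congr 1
    abel
  have hCS := real_inner_le_norm (w - w') (p - p')
  by_contra! hlt
  nlinarith [norm_nonneg (w - w')]

namespace Game

variable {N m d : ℕ} {G : Game N m d} {Y : Set (Vec m)}

lemma others_eq (x : Fin N → Vec m) (i : Fin N) : others x i = ∑ j, x j - x i := by
  rw [others, eq_sub_iff_add_eq, Finset.sum_erase_add _ _ (Finset.mem_univ i)]

/-- First-order optimality condition of a Nash equilibrium. -/
lemma IsNash.inner_nonneg (hG : G.Regular Y) {xs : Fin N → Vec m} (hxs : G.IsNash xs) (i : Fin N)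
    {y : Vec m} (hy : y ∈ G.R i) :
    0 ≤ inner ℝ (G.φ xs i) (y - xs i) + (G.r i y - G.r i (xs i)) := by
  have hmemY : ∑ j, xs j ∈ Y := hG.subset ⟨xs, fun j => (hxs j).1, rfl⟩
  have hdiff := hG.f_diff i (xs i) (hxs i).1 _ hmemY
  set F : Vec m → ℝ := fun t => G.f i t (t + (∑ j, xs j - xs i)) with hF
  have hgrad : HasFDerivAt F (InnerProductSpace.toDual ℝ (Vec m) (G.φ xs i)) (xs i) :=
    (show DifferentiableAt ℝ F (xs i) from hdiff).hasGradientAt.hasFDerivAt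
  have hline : HasDerivAt (fun t : ℝ => F (xs i + t • (y - xs i)))
      (inner ℝ (G.φ xs i) (y - xs i)) 0 := by
    have h1 : HasDerivAt (fun t : ℝ => xs i + t • (y - xs i)) (y - xs i) 0 := by
      simpa using ((hasDerivAt_id (0 : ℝ)).smul_const (y - xs i)).const_add (xs i)
    have h2 : HasFDerivAt F (InnerProductSpace.toDual ℝ (Vec m) (G.φ xs i))
        (xs i + (0 : ℝ) • (y - xs i)) := by simpa using hgrad
    have h3 := h2.comp_hasDerivAt (0 : ℝ) h1
    rw [InnerProductSpace.toDual_apply_apply] at h3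
    exact h3
  have hslope := hline.tendsto_slope_zero_right
  simp only [zero_add, zero_smul, add_zero] at hslope
  refine ge_of_tendsto (hslope.add_const (G.r i y - G.r i (xs i))) ?_
  filter_upwards [Ioc_mem_nhdsGT (zero_lt_one' ℝ)] with t ht
  have heq : (1 - t) • xs i + t • y = xs i + t • (y - xs i) := by module
  have hconv := (hG.convex i).2 (hxs i).1 hy (sub_nonneg.2 ht.2) ht.1.le (by ring)
  have hmem := (hG.convex i).1 (hxs i).1 hy (sub_nonneg.2 ht.2) ht.1.le (by ring)
  have hmin := (hxs i).2 _ hmem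
  rw [heq] at hconv hmin
  simp only [cost, others_eq, smul_eq_mul] at hconv hmin
  change F (xs i) + _ ≤ F _ + _ at hmin
  have : t⁻¹ • (F (xs i + t • (y - xs i)) - F (xs i)) + (G.r i y - G.r i (xs i))
      = t⁻¹ * (F (xs i + t • (y - xs i)) - F (xs i) + t * (G.r i y - G.r i (xs i))) := by
    have := ht.1.ne'
    simp only [smul_eq_mul]
    field_simp
  rw [this]
  exact mul_nonneg (inv_nonneg.2 ht.1.le) (by nlinarith)

/-- One proximal step compared with the equilibrium, which is a fixed point of the exact proximal
gradient map. -/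
lemma IsNash.norm_prox_sub_le (hG : G.Regular Y) {xs : Fin N → Vec m} (hxs : G.IsNash xs)
    {α : ℝ} (hα : 0 < α) (i : Fin N) {w p : Vec m} (hp : IsProx α (G.R i) (G.r i) w p) :
    ‖p - xs i‖ ≤ ‖w - (xs i - α • G.φ xs i)‖ := by
  refine norm_sub_le_of_inner_le (hp.inner_le hα (hG.convex i) (hxs i).1) ?_
  have h := hxs.inner_nonneg hG i hp.1
  rw [show xs i - α • G.φ xs i - xs i = -(α • G.φ xs i) by abel, inner_neg_left,
    real_inner_smul_left]
  nlinarith [mul_nonneg hα.le h]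

lemma norm_le_sSup (hG : G.Regular Y) {i : Fin N} {x : Vec m} (hx : x ∈ G.R i) :
    ‖x‖ ≤ sSup ((fun x : Vec m => ‖x‖) '' G.R i) :=
  le_csSup ((hG.compact i).image continuous_norm).bddAbove ⟨x, hx, rfl⟩

lemma sum_norm_le_M (hG : G.Regular Y) {x : Fin N → Vec m} (hx : x ∈ G.profiles) :
    ∑ j, ‖x j‖ ≤ G.M :=
  Finset.sum_le_sum fun j _ => norm_le_sSup hG (hx j)

lemma norm_sub_le_M (hG : G.Regular Y) {x y : Fin N → Vec m} (hx : x ∈ G.profiles)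
    (hy : y ∈ G.profiles) (i : Fin N) : ‖x i - y i‖ ≤ 2 * G.M := by
  have h : ∀ z ∈ G.profiles, ‖z i‖ ≤ G.M := fun z hz =>
    (Finset.single_le_sum (f := fun j => ‖z j‖) (fun j _ => norm_nonneg _)
      (Finset.mem_univ i)).trans (sum_norm_le_M hG hz)
  linarith [norm_sub_le (x i) (y i), h x hx, h y hy]

/-- Contraction of a forward step whose gradients are evaluated at estimates `y i` of the
aggregate with error at most `E`. -/
lemma forward_step_le (hG : G.Regular Y) {η L : ℝ} (hmono : G.StronglyMonotone η)
    (hLip : G.LipschitzMap L) {ℓ : Fin N → ℝ} (hℓ : ∀ i, 0 ≤ ℓ i) (hLipAgg : G.LipschitzAgg Y ℓ)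
    {α : ℝ} (hα : 0 < α) {x xs y : Fin N → Vec m} (hx : x ∈ G.profiles) (hxs : xs ∈ G.profiles)
    (hy : ∀ i, y i ∈ Y) {E : ℝ} (hE : ∀ i, ‖y i - ∑ j, x j‖ ≤ E) :
    ∑ i, ‖x i - xs i - α • (G.gradf i (x i) (y i) - G.φ xs i)‖ ^ 2 ≤
      rate α η L * ∑ i, ‖x i - xs i‖ ^ 2 + 4 * α * G.M * E * ∑ i, ℓ i
        + 2 * α ^ 2 * E ^ 2 * ∑ i, ℓ i ^ 2 := by
  have hM : 0 ≤ G.M := (Finset.sum_nonneg fun j _ => norm_nonneg _).trans (sum_norm_le_M hG hx)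
  have hLip2 : ∑ i, ‖G.φ x i - G.φ xs i‖ ^ 2 ≤ L ^ 2 * ∑ i, ‖x i - xs i‖ ^ 2 := by
    have h := pow_le_pow_left₀ (Real.sqrt_nonneg _) (hLip x hx xs hxs) 2
    rwa [mul_pow, Real.sq_sqrt (by positivity), Real.sq_sqrt (by positivity)] at h
  have hterm : ∀ i, ‖x i - xs i - α • (G.gradf i (x i) (y i) - G.φ xs i)‖ ^ 2 ≤
      ‖x i - xs i‖ ^ 2 - 2 * α * inner ℝ (G.φ x i - G.φ xs i) (x i - xs i)
        + 2 * α ^ 2 * ‖G.φ x i - G.φ xs i‖ ^ 2 + 4 * α * G.M * E * ℓ i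
        + 2 * α ^ 2 * E ^ 2 * ℓ i ^ 2 := by
    intro i
    have hd : ‖G.gradf i (x i) (y i) - G.φ x i‖ ≤ ℓ i * E :=
      (hLipAgg i (x i) (hx i) (y i) (hy i) _ (hG.subset ⟨x, hx, rfl⟩)).trans
        (mul_le_mul_of_nonneg_left (hE i) (hℓ i))
    set δ := G.gradf i (x i) (y i) - G.φ x i with hδ
    set D := G.φ x i - G.φ xs i with hD
    set z := x i - xs i with hz
    have hsplit : G.gradf i (x i) (y i) - G.φ xs i = D + δ := by rw [hδ, hD]; abel
    rw [hsplit, norm_sub_sq_real, inner_smul_right, inner_add_right, norm_smul, mul_pow,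
      Real.norm_eq_abs, sq_abs, real_inner_comm]
    have h1 : -inner ℝ z δ ≤ 2 * G.M * (ℓ i * E) := by
      have := abs_le.1 (abs_real_inner_le_norm z δ)
      have hz' := norm_sub_le_M hG hx hxs i
      have h2 : ‖z‖ * ‖δ‖ ≤ 2 * G.M * (ℓ i * E) :=
        mul_le_mul hz' hd (norm_nonneg _) (by positivity)
      linarith [this.1]
    have h2 : ‖D + δ‖ ^ 2 ≤ 2 * ‖D‖ ^ 2 + 2 * (ℓ i * E) ^ 2 := by
      have h3 := pow_le_pow_left₀ (norm_nonneg _) (norm_add_le D δ) 2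
      have h4 := pow_le_pow_left₀ (norm_nonneg _) hd 2
      nlinarith [sq_nonneg (‖D‖ - ‖δ‖)]
    have h3 := mul_le_mul_of_nonneg_left h1 hα.le
    have h4 := mul_le_mul_of_nonneg_left h2 (sq_nonneg α)
    nlinarith
  refine (Finset.sum_le_sum fun i _ => hterm i).trans ?_
  simp only [Finset.sum_add_distrib, Finset.sum_sub_distrib, ← Finset.mul_sum]
  have h1 := mul_le_mul_of_nonneg_left (hmono x hx xs hxs) hα.le
  have h2 := mul_le_mul_of_nonneg_left hLip2 (sq_nonneg α)
  unfold rate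
  nlinarith

end Game

/-! ### The stochastic iteration -/

lemma integrable_inner_of_bounded {Ω E : Type*} [MeasurableSpace Ω] [NormedAddCommGroup E]
    [InnerProductSpace ℝ E] {P : Measure Ω} {h e : Ω → E} {B : ℝ}
    (hm : AEStronglyMeasurable h P) (hB : ∀ ω, ‖h ω‖ ≤ B) (he : Integrable e P) :
    Integrable (fun ω => inner ℝ (h ω) (e ω)) P := by
  refine (he.norm.const_mul B).mono' (hm.inner he.aestronglyMeasurable) (ae_of_all _ fun ω => ?_)
  exact (norm_inner_le_norm _ _).trans (mul_le_mul_of_nonneg_right (hB ω) (norm_nonneg _))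

/-- A conditionally centred random vector is orthogonal to bounded vectors known at that time. -/
lemma integral_inner_eq_zero {Ω E : Type*} {m m0 : MeasurableSpace Ω} [NormedAddCommGroup E]
    [InnerProductSpace ℝ E] [CompleteSpace E] {P : Measure Ω} [IsFiniteMeasure P] (hm : m ≤ m0)
    {h e : Ω → E} {B : ℝ} (hmeas : StronglyMeasurable[m] h) (hB : ∀ ω, ‖h ω‖ ≤ B)
    (he : Integrable e P) (hcond : P[e | m] =ᵐ[P] 0) :
    ∫ ω, inner ℝ (h ω) (e ω) ∂P = 0 := by
  have hint := integrable_inner_of_bounded (hmeas.mono hm).aestronglyMeasurable hB he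
  have hpull := condExp_bilin_of_stronglyMeasurable_left
    (isBoundedBilinearMap_inner (𝕜 := ℝ) (E := E)).toContinuousLinearMap hmeas hint he
  calc ∫ ω, inner ℝ (h ω) (e ω) ∂P
      = ∫ ω, (P[fun ω => inner ℝ (h ω) (e ω) | m]) ω ∂P := (integral_condExp hm).symm
    _ = ∫ _, (0 : ℝ) ∂P := by
        refine integral_congr_ae ?_
        filter_upwards [hpull, hcond] with ω h1 h2
        refine h1.trans ?_
        rw [h2]
        exact inner_zero_right _
    _ = 0 := by simp

/-- The gradient map of a player is jointly continuous in the decision and the aggregate, being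
continuous in the former and Lipschitz in the latter. -/
lemma Game.continuousOn_gradf {N m d : ℕ} {G : Game N m d} {Y : Set (Vec m)} (hG : G.Regular Y)
    {ℓ : Fin N → ℝ} (hLipAgg : G.LipschitzAgg Y ℓ) (i : Fin N) :
    ContinuousOn (fun p : Vec m × Vec m => G.gradf i p.1 p.2) (G.R i ×ˢ Y) := by
  refine continuousOn_prod_of_continuousOn_lipschitzOnWith' _ (ℓ i).toNNReal (fun x hx => ?_)
    (fun y hy => hG.gradf_cont i y hy)
  refine LipschitzOnWith.of_dist_le_mul fun y₁ h₁ y₂ h₂ => ?_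
  rw [dist_eq_norm, dist_eq_norm]
  exact (hLipAgg i x hx y₁ h₁ y₂ h₂).trans
    (mul_le_mul_of_nonneg_right (Real.le_coe_toNNReal _) (norm_nonneg _))

namespace Run

variable {N m d : ℕ} {Ω : Type*} [MeasurableSpace Ω] {G : Game N m d}
  {A : Matrix (Fin N) (Fin N) ℝ} {α : ℝ} {τ n : ℕ → ℕ} {Y : Set (Vec m)} {P : Measure Ω}
  (S : Run G A α τ n Y P)

lemma filtration_le (k : ℕ) : S.𝓕 k ≤ ‹MeasurableSpace Ω› :=
  iSup₂_le fun j _ => (S.x_meas j).comap_le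

lemma filtration_mono {j k : ℕ} (h : j ≤ k) : S.𝓕 j ≤ S.𝓕 k :=
  biSup_mono fun i hi => by
    rw [Finset.mem_range] at hi ⊢
    omega

lemma measurable_x {j k : ℕ} (h : j ≤ k) : Measurable[S.𝓕 k] (S.x j) := by
  rw [measurable_iff_comap_le]
  exact le_iSup₂ (f := fun j (_ : j ∈ Finset.range (k + 1)) =>
    MeasurableSpace.comap (S.x j) inferInstance) j (Finset.mem_range.2 (by omega))

lemma mem_profiles (k : ℕ) (ω : Ω) : S.x k ω ∈ G.profiles := by
  cases k with
  | zero => exact S.x_zero ω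
  | succ k => exact fun i => (S.x_succ k ω i).1

lemma continuous_consensus (A : Matrix (Fin N) (Fin N) ℝ) (t : ℕ) (i : Fin N) :
    Continuous fun z : Fin N → Vec m => consensus A t z i := by
  simp_rw [consensus_apply]
  fun_prop

/-- The estimates of the average are functions of the past decisions. -/
lemma measurable_v (k : ℕ) : Measurable[S.𝓕 k] (S.v k) := by
  induction k with
  | zero =>
    rw [show S.v 0 = S.x 0 from funext S.v_zero]
    exact S.measurable_x le_rfl
  | succ k ih =>
    have hv : Measurable[S.𝓕 (k + 1)] (S.v k) := ih.mono (S.filtration_mono k.le_succ) le_rfl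
    have hx := S.measurable_x (Nat.le_succ k)
    have hx' := S.measurable_x (le_refl (k + 1))
    rcases S.v_succ with h | h
    · rw [show S.v (k + 1) = fun ω i => S.v k ω i + S.x (k + 1) ω i - S.x k ω i from
        funext fun ω => funext fun i => h k ω i]
      exact @measurable_pi_lambda _ _ _ (S.𝓕 (k + 1)) _ _ fun i =>
        (((measurable_pi_apply i).comp hv).add ((measurable_pi_apply i).comp hx')).sub
          ((measurable_pi_apply i).comp hx)
    · rw [show S.v (k + 1) = fun ω i =>
          consensus A (τ k) (S.v k ω) i + S.x (k + 1) ω i - S.x k ω i from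
        funext fun ω => funext fun i => h k ω i]
      exact @measurable_pi_lambda _ _ _ (S.𝓕 (k + 1)) _ _ fun i =>
        (((continuous_consensus A (τ k) i).measurable.comp hv).add
          ((measurable_pi_apply i).comp hx')).sub ((measurable_pi_apply i).comp hx)

/-- The exact gradients at the estimated aggregates are functions of the past decisions. -/
lemma measurable_gradf (hG : G.Regular Y) {ℓ : Fin N → ℝ} (hLipAgg : G.LipschitzAgg Y ℓ) (k : ℕ)
    (i : Fin N) :
    Measurable[S.𝓕 k] fun ω =>
      G.gradf i (S.x k ω i) ((N : ℝ) • consensus A (τ k) (S.v k ω) i) := by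
  have hx : Measurable[S.𝓕 k] fun ω => S.x k ω i :=
    (measurable_pi_apply i).comp (S.measurable_x le_rfl)
  have hy : Measurable[S.𝓕 k] fun ω => (N : ℝ) • consensus A (τ k) (S.v k ω) i :=
    ((continuous_consensus A (τ k) i).measurable.comp (S.measurable_v k)).const_smul (N : ℝ)
  have hcont : Measurable fun p : ↥(G.R i ×ˢ Y) => G.gradf i p.1.1 p.1.2 :=
    (Game.continuousOn_gradf hG hLipAgg i).domRestrict.measurable
  have hpair : Measurable[S.𝓕 k] fun ω => (⟨(S.x k ω i,
      (N : ℝ) • consensus A (τ k) (S.v k ω) i), S.mem_profiles k ω i, S.mem_Y k ω i⟩ :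
      ↥(G.R i ×ˢ Y)) :=
    @Measurable.subtype_mk _ _ (S.𝓕 k) _ _ _ (hx.prodMk hy) _
  have hcomp := hcont.comp hpair
  exact hcomp

lemma integrable_sum_sq [IsProbabilityMeasure P] (hG : G.Regular Y) {xs : Fin N → Vec m}
    (hxs : xs ∈ G.profiles) (k : ℕ) : Integrable (fun ω => ∑ i, ‖S.x k ω i - xs i‖ ^ 2) P := by
  refine integrable_finsetSum _ fun i _ => ?_
  refine Integrable.of_bound (C := (2 * G.M) ^ 2) ?_ (ae_of_all _ fun ω => ?_)
  · have : Measurable fun ω => S.x k ω i := (measurable_pi_apply i).comp (S.x_meas k)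
    exact ((this.sub_const _).norm.pow_const 2).aestronglyMeasurable
  · rw [Real.norm_of_nonneg (by positivity)]
    exact pow_le_pow_left₀ (norm_nonneg _)
      (Game.norm_sub_le_M hG (S.mem_profiles k ω) hxs i) 2

/-- One iteration: the conditionally centred gradient error enters the mean-squared error only
through its second moment. -/
lemma mse_succ_le [IsProbabilityMeasure P] (hG : G.Regular Y) {η L : ℝ}
    (hmono : G.StronglyMonotone η) (hLip : G.LipschitzMap L) {ℓ : Fin N → ℝ} (hℓ : ∀ i, 0 ≤ ℓ i)
    (hLipAgg : G.LipschitzAgg Y ℓ) {xs : Fin N → Vec m} (hxs : G.IsNash xs) (hα : 0 < α)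
    {ν : Fin N → ℝ} (hS : S.Noise ν) (k : ℕ) {E : ℝ}
    (hE : ∀ ω i, ‖(N : ℝ) • consensus A (τ k) (S.v k ω) i - ∑ j, S.x k ω j‖ ≤ E) :
    S.mse xs (k + 1) ≤ rate α η L * S.mse xs k + 4 * α * G.M * E * ∑ i, ℓ i
      + 2 * α ^ 2 * E ^ 2 * ∑ i, ℓ i ^ 2 + α ^ 2 * ∑ i, ν i ^ 2 / (n k : ℝ) := by
  have hxs' : xs ∈ G.profiles := fun i => (hxs i).1
  set h : Fin N → Ω → Vec m := fun i ω => S.x k ω i - xs i -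
    α • (G.gradf i (S.x k ω i) ((N : ℝ) • consensus A (τ k) (S.v k ω) i) - G.φ xs i) with hh
  set D : ℝ := 4 * α * G.M * E * ∑ i, ℓ i + 2 * α ^ 2 * E ^ 2 * ∑ i, ℓ i ^ 2 with hD
  have hfwd : ∀ ω, ∑ i, ‖h i ω‖ ^ 2 ≤
      rate α η L * ∑ i, ‖S.x k ω i - xs i‖ ^ 2 + D := fun ω => by
    have := Game.forward_step_le hG hmono hLip hℓ hLipAgg hα (S.mem_profiles k ω) hxs'
      (fun i => S.mem_Y k ω i) (hE ω)
    rw [hD, ← add_assoc]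
    exact this
  have hmeas : ∀ i, StronglyMeasurable[S.𝓕 k] (h i) := fun i => by
    have hx : Measurable[S.𝓕 k] fun ω => S.x k ω i :=
      (measurable_pi_apply i).comp (S.measurable_x le_rfl)
    have : Measurable[S.𝓕 k] (h i) := (hx.sub_const (xs i)).sub
      (((S.measurable_gradf hG hLipAgg k i).sub_const (G.φ xs i)).const_smul α)
    exact this.stronglyMeasurable
  have hmeas0 : ∀ i, AEStronglyMeasurable (h i) P := fun i =>
    ((hmeas i).mono (S.filtration_le k)).aestronglyMeasurable
  obtain ⟨B, hB⟩ : ∃ B, ∀ i ω, ‖h i ω‖ ≤ B := by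
    refine ⟨Real.sqrt (|rate α η L| * (∑ _i : Fin N, (2 * G.M) ^ 2) + D), fun i ω => ?_⟩
    refine Real.le_sqrt_of_sq_le ?_
    have h1 : ‖h i ω‖ ^ 2 ≤ ∑ i, ‖h i ω‖ ^ 2 :=
      Finset.single_le_sum (f := fun i => ‖h i ω‖ ^ 2) (fun _ _ => by positivity)
        (Finset.mem_univ i)
    have h2 : rate α η L * ∑ i, ‖S.x k ω i - xs i‖ ^ 2
        ≤ |rate α η L| * ∑ _i : Fin N, (2 * G.M) ^ 2 := by
      refine mul_le_mul (le_abs_self _) (Finset.sum_le_sum fun i _ => ?_) (by positivity)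
        (abs_nonneg _)
      exact pow_le_pow_left₀ (norm_nonneg _)
        (Game.norm_sub_le_M hG (S.mem_profiles k ω) hxs' i) 2
    linarith [hfwd ω]
  have heint : ∀ i, Integrable (S.e k i) P := fun i => (hS.memLp k i).integrable (by norm_num)
  have he2 : ∀ i, Integrable (fun ω => ‖S.e k i ω‖ ^ 2) P := fun i =>
    (hS.memLp k i).integrable_norm_pow (by norm_num)
  have hinner : ∀ i, Integrable (fun ω => inner ℝ (h i ω) (S.e k i ω)) P := fun i =>
    integrable_inner_of_bounded (hmeas0 i) (hB i) (heint i)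
  have hinner0 : ∀ i, ∫ ω, inner ℝ (h i ω) (S.e k i ω) ∂P = 0 := fun i =>
    integral_inner_eq_zero (S.filtration_le k) (hmeas i) (hB i) (heint i) (hS.mean k i)
  have hvar : ∀ i, ∫ ω, ‖S.e k i ω‖ ^ 2 ∂P ≤ ν i ^ 2 / (n k : ℝ) := fun i => by
    rw [← integral_condExp (S.filtration_le k)]
    refine (integral_mono_ae integrable_condExp (integrable_const _)
      (hS.second_moment k i)).trans ?_
    simp
  have hstep : ∀ ω, ∑ i, ‖S.x (k + 1) ω i - xs i‖ ^ 2 ≤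
      rate α η L * ∑ i, ‖S.x k ω i - xs i‖ ^ 2 + D
        + ∑ i, (-(2 * α) * inner ℝ (h i ω) (S.e k i ω) + α ^ 2 * ‖S.e k i ω‖ ^ 2) := by
    intro ω
    refine le_trans ?_ (add_le_add_left (hfwd ω) _)
    rw [← Finset.sum_add_distrib]
    refine Finset.sum_le_sum fun i _ => ?_
    have h1 := hxs.norm_prox_sub_le hG hα i (S.x_succ k ω i)
    have h2 : S.x k ω i - α • sampleGrad G i (S.x k ω i)
        ((N : ℝ) • consensus A (τ k) (S.v k ω) i) (n k) (fun p => S.ξ k p ω)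
          - (xs i - α • G.φ xs i) = h i ω - α • S.e k i ω := by
      simp only [hh, Run.e]
      module
    rw [h2] at h1
    refine (pow_le_pow_left₀ (norm_nonneg _) h1 2).trans (le_of_eq ?_)
    rw [norm_sub_sq_real, inner_smul_right, norm_smul, mul_pow, Real.norm_eq_abs, sq_abs]
    ring
  have hint1 : Integrable (fun ω => rate α η L * ∑ i, ‖S.x k ω i - xs i‖ ^ 2 + D) P :=
    ((S.integrable_sum_sq hG hxs' k).const_mul _).add (integrable_const _)
  have hint2 : ∀ i, Integrable (fun ω =>
      -(2 * α) * inner ℝ (h i ω) (S.e k i ω) + α ^ 2 * ‖S.e k i ω‖ ^ 2) P := fun i =>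
    ((hinner i).const_mul _).add ((he2 i).const_mul _)
  calc S.mse xs (k + 1)
      ≤ ∫ ω, (rate α η L * ∑ i, ‖S.x k ω i - xs i‖ ^ 2 + D
        + ∑ i, (-(2 * α) * inner ℝ (h i ω) (S.e k i ω) + α ^ 2 * ‖S.e k i ω‖ ^ 2)) ∂P :=
        integral_mono (S.integrable_sum_sq hG hxs' (k + 1))
          (hint1.add (integrable_finsetSum _ fun i _ => hint2 i)) hstep
    _ = rate α η L * S.mse xs k + D + ∑ i, α ^ 2 * ∫ ω, ‖S.e k i ω‖ ^ 2 ∂P := by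
        rw [integral_add hint1 (integrable_finsetSum _ fun i _ => hint2 i),
          integral_add ((S.integrable_sum_sq hG hxs' k).const_mul _) (integrable_const _),
          integral_const_mul, integral_finsetSum _ fun i _ => hint2 i]
        congr 1
        · simp [mse]
        · refine Finset.sum_congr rfl fun i _ => ?_
          rw [integral_add ((hinner i).const_mul _) ((he2 i).const_mul _), integral_const_mul,
            integral_const_mul, hinner0 i, mul_zero, zero_add]
    _ ≤ rate α η L * S.mse xs k + D + ∑ i, α ^ 2 * (ν i ^ 2 / (n k : ℝ)) := by
        gcongr with i
        exact hvar i
    _ = _ := by rw [← Finset.mul_sum, hD]; ring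

end Run

/-! ### Solving the error recursion -/

lemma log_one_div_pos {q : ℝ} (hq0 : 0 < q) (hq1 : q < 1) : 0 < Real.log (1 / q) :=
  Real.log_pos (by rw [lt_div_iff₀ hq0]; linarith)

lemma sq_rpow_half {q : ℝ} (hq0 : 0 < q) : (q ^ 2) ^ (1 / 2 : ℝ) = q := by
  rw [← Real.rpow_natCast, ← Real.rpow_mul hq0.le]; norm_num

lemma sq_rpow_batch {q : ℝ} (hq0 : 0 < q) (k : ℕ) :
    (q ^ 2) ^ (-((k : ℝ) + 1) / 2) = (1 / q) ^ (k + 1) := by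
  rw [one_div, inv_pow, ← Real.rpow_natCast q (k + 1), ← Real.rpow_neg hq0.le,
    ← Real.rpow_natCast q 2, ← Real.rpow_mul hq0.le]
  congr 1
  push_cast
  ring

lemma le_batch {q : ℝ} (hq0 : 0 < q) (k : ℕ) : (1 / q) ^ (k + 1) ≤ (batch (q ^ 2) k : ℝ) := by
  rw [← sq_rpow_batch hq0]; exact Nat.le_ceil _

lemma batch_le {q : ℝ} (hq0 : 0 < q) (k : ℕ) :
    (batch (q ^ 2) k : ℝ) ≤ (1 / q) ^ (k + 1) + 1 := by
  rw [← sq_rpow_batch hq0]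
  exact (Nat.ceil_lt_add_one (by positivity)).le

lemma C₃_sq {N : ℕ} (M θ α : ℝ) (ℓ ν : Fin N → ℝ) {q : ℝ} (hq0 : 0 < q) :
    C₃ M θ (q ^ 2) α ℓ ν = α ^ 2 * ∑ i, ν i ^ 2 +
      4 * α * M * N * (C₁ M θ (q ^ 2) * q + C₂ M θ (q ^ 2)) * ∑ i, ℓ i +
      4 * α ^ 2 * (N : ℝ) ^ 2 *
        (C₁ M θ (q ^ 2) ^ 2 * q ^ 3 + C₂ M θ (q ^ 2) ^ 2 * q) * ∑ i, ℓ i ^ 2 := by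
  have h3 : (q ^ 2) ^ (3 / 2 : ℝ) = q ^ 3 := by
    rw [← Real.rpow_natCast, ← Real.rpow_mul hq0.le, ← Real.rpow_natCast]; norm_num
  rw [C₃, sq_rpow_half hq0, h3]

lemma C₃_nonneg {N : ℕ} {M θ α q : ℝ} {ℓ : Fin N → ℝ} (ν : Fin N → ℝ) (hM : 0 ≤ M) (hθ : 0 ≤ θ)
    (hα : 0 ≤ α) (hℓ : ∀ i, 0 ≤ ℓ i) (hq0 : 0 < q) (hq1 : q < 1) :
    0 ≤ C₃ M θ (q ^ 2) α ℓ ν := by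
  have h1 := C₁_nonneg (β := q ^ 2) hM hθ
  have h2 := C₂_nonneg hM hθ (pow_pos hq0 2) (pow_lt_one₀ hq0.le hq1 (by norm_num))
  have h3 : 0 ≤ ∑ i, ℓ i := Finset.sum_nonneg fun i _ => hℓ i
  rw [C₃_sq M θ α ℓ ν hq0]
  positivity

/-- The mean-squared error contracts by `ϱ` up to perturbations of order `β ^ (k / 2)`, to which
both the sampling noise and the consensus error are bounded. -/
lemma Run.mse_succ_le_geometric {N m d : ℕ} {Ω : Type*} [MeasurableSpace Ω] {P : Measure Ω}
    [IsProbabilityMeasure P] {G : Game N m d} {Y : Set (Vec m)} (hG : G.Regular Y)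
    {A : Matrix (Fin N) (Fin N) ℝ} {η L : ℝ}
    (hmono : G.StronglyMonotone η) (hLip : G.LipschitzMap L) {ℓ : Fin N → ℝ} (hℓ : ∀ i, 0 ≤ ℓ i)
    (hLipAgg : G.LipschitzAgg Y ℓ) {xs : Fin N → Vec m} (hxs : G.IsNash xs)
    {α : ℝ} (hα : 0 < α) {θ q : ℝ} (hq0 : 0 < q) (hq1 : q < 1) (hmix : Mixing A θ (q ^ 2))
    (S : Run G A α tau (batch (q ^ 2)) Y P) {ν : Fin N → ℝ} (hS : S.Noise ν) (k : ℕ) :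
    S.mse xs (k + 1) ≤
      rate α η L * S.mse xs k + C₃ G.M θ (q ^ 2) α ℓ ν * q ^ (k + 1) := by
  have hM : 0 ≤ G.M := (Finset.sum_nonneg fun j _ => norm_nonneg (xs j)).trans
    (Game.sum_norm_le_M hG fun i => (hxs i).1)
  have hθ : 0 ≤ θ := hmix.1.le
  have h1 := C₁_nonneg (β := q ^ 2) hM hθ
  have h2 := C₂_nonneg hM hθ hmix.2.1 hmix.2.2.1
  have hℓs : 0 ≤ ∑ i, ℓ i := Finset.sum_nonneg fun i _ => hℓ i
  have hℓs2 : 0 ≤ ∑ i, ℓ i ^ 2 := Finset.sum_nonneg fun i _ => by positivity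
  set c₁ := C₁ G.M θ (q ^ 2) with hc₁
  set c₂ := C₂ G.M θ (q ^ 2) with hc₂
  set E : ℝ := N * (c₁ * q ^ (k + 2) + c₂ * q ^ (k + 1)) with hEdef
  have hE : ∀ ω i, ‖(N : ℝ) • consensus A (tau k) (S.v k ω) i - ∑ j, S.x k ω j‖ ≤ E := by
    intro ω i
    have hN : (0 : ℝ) < N := by exact_mod_cast i.pos
    have hcons := norm_consensus_sub_average_le hmix (τ := tau) (x := fun k => S.x k ω)
      (v := fun k => S.v k ω) (fun k => Game.sum_norm_le_M hG (S.mem_profiles k ω)) (S.v_zero ω)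
      (S.v_succ.imp (fun h k i => h k ω i) (fun h k i => h k ω i)) k (tau k) i
    have heq : (N : ℝ) • consensus A (tau k) (S.v k ω) i - ∑ j, S.x k ω j
        = (N : ℝ) • (consensus A (tau k) (S.v k ω) i - (N : ℝ)⁻¹ • ∑ j, S.x k ω j) := by
      rw [smul_sub, smul_smul, mul_inv_cancel₀ hN.ne', one_smul]
    rw [heq, norm_smul, Real.norm_of_nonneg hN.le]
    exact mul_le_mul_of_nonneg_left (hcons.trans (consensus_rate_le hM hθ hq0 hq1 k)) hN.le
  have hmain := S.mse_succ_le hG hmono hLip hℓ hLipAgg hxs hα hS k hE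
  have hnoise : α ^ 2 * ∑ i, ν i ^ 2 / (batch (q ^ 2) k : ℝ)
      ≤ α ^ 2 * (∑ i, ν i ^ 2) * q ^ (k + 1) := by
    rw [mul_assoc, Finset.sum_mul]
    gcongr with i
    calc ν i ^ 2 / (batch (q ^ 2) k : ℝ) ≤ ν i ^ 2 / (1 / q) ^ (k + 1) := by
          gcongr
          exact le_batch hq0 k
      _ = ν i ^ 2 * q ^ (k + 1) := by rw [one_div, inv_pow, div_inv_eq_mul]
  have hE1 : 4 * α * G.M * E * ∑ i, ℓ i =
      4 * α * G.M * N * (c₁ * q + c₂) * (∑ i, ℓ i) * q ^ (k + 1) := by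
    rw [hEdef]; ring
  have hE2 : 2 * α ^ 2 * E ^ 2 * ∑ i, ℓ i ^ 2 ≤
      4 * α ^ 2 * (N : ℝ) ^ 2 * (c₁ ^ 2 * q ^ 3 + c₂ ^ 2 * q) * (∑ i, ℓ i ^ 2) * q ^ (k + 1) := by
    have hsq : (c₁ * q ^ (k + 2) + c₂ * q ^ (k + 1)) ^ 2 ≤
        2 * ((c₁ ^ 2 * q ^ 3 + c₂ ^ 2 * q) * q ^ (k + 1)) := by
      have hqk : q ^ k ≤ 1 := pow_le_one₀ hq0.le hq1.le
      calc (c₁ * q ^ (k + 2) + c₂ * q ^ (k + 1)) ^ 2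
          ≤ 2 * ((c₁ * q ^ (k + 2)) ^ 2 + (c₂ * q ^ (k + 1)) ^ 2) := by
            nlinarith [sq_nonneg (c₁ * q ^ (k + 2) - c₂ * q ^ (k + 1))]
        _ = 2 * ((c₁ ^ 2 * q ^ 3 + c₂ ^ 2 * q) * q ^ (k + 1) * q ^ k) := by ring
        _ ≤ 2 * ((c₁ ^ 2 * q ^ 3 + c₂ ^ 2 * q) * q ^ (k + 1) * 1) := by gcongr
        _ = _ := by ring
    calc 2 * α ^ 2 * E ^ 2 * ∑ i, ℓ i ^ 2
        = 2 * α ^ 2 * (N : ℝ) ^ 2 * (∑ i, ℓ i ^ 2)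
            * (c₁ * q ^ (k + 2) + c₂ * q ^ (k + 1)) ^ 2 := by rw [hEdef]; ring
      _ ≤ 2 * α ^ 2 * (N : ℝ) ^ 2 * (∑ i, ℓ i ^ 2)
            * (2 * ((c₁ ^ 2 * q ^ 3 + c₂ ^ 2 * q) * q ^ (k + 1))) := by gcongr
      _ = _ := by ring
  rw [C₃_sq _ _ _ _ _ hq0, ← hc₁, ← hc₂]
  linarith

lemma sum_pow_le {s : ℝ} (hs0 : 0 ≤ s) (hs1 : s < 1) (k : ℕ) :
    ∑ j ∈ Finset.range k, s ^ j ≤ 1 / (1 - s) := by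
  rw [one_div, ← tsum_geometric_of_lt_one hs0 hs1]
  exact (summable_geometric_of_lt_one hs0 hs1).sum_le_tsum _ fun _ _ => pow_nonneg hs0 _

section Recursion

variable {u : ℕ → ℝ} {C c ϱ q : ℝ}

lemma recursion_le_sum (hϱ : 0 < ϱ) (h0 : u 0 ≤ C)
    (hu : ∀ k, u (k + 1) ≤ ϱ * u k + c * q ^ (k + 1)) (k : ℕ) :
    u k ≤ (C + c * ∑ j ∈ Finset.range k, (q / ϱ) ^ (j + 1)) * ϱ ^ k := by
  induction k with
  | zero => simpa using h0
  | succ k ih =>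
    have hq : q ^ (k + 1) = (q / ϱ) ^ (k + 1) * ϱ ^ (k + 1) := by
      rw [← mul_pow, div_mul_cancel₀ _ hϱ.ne']
    calc u (k + 1) ≤ ϱ * u k + c * q ^ (k + 1) := hu k
      _ ≤ ϱ * ((C + c * ∑ j ∈ Finset.range k, (q / ϱ) ^ (j + 1)) * ϱ ^ k)
            + c * q ^ (k + 1) := by gcongr
      _ = _ := by rw [Finset.sum_range_succ, hq]; ring

lemma recursion_le_of_lt (hϱ : 0 < ϱ) (hq : 0 < q) (hqϱ : q < ϱ) (hc : 0 ≤ c) (h0 : u 0 ≤ C)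
    (hu : ∀ k, u (k + 1) ≤ ϱ * u k + c * q ^ (k + 1)) (k : ℕ) :
    u k ≤ (C + c / (1 - q / ϱ)) * ϱ ^ k := by
  have hs0 : 0 < q / ϱ := by positivity
  have hs1 : q / ϱ < 1 := (div_lt_one hϱ).2 hqϱ
  refine (recursion_le_sum hϱ h0 hu k).trans ?_
  have : ∑ j ∈ Finset.range k, (q / ϱ) ^ (j + 1) ≤ 1 / (1 - q / ϱ) :=
    (Finset.sum_le_sum fun j _ => pow_le_pow_of_le_one hs0.le hs1.le j.le_succ).trans
      (sum_pow_le hs0.le hs1 k)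
  calc _ ≤ (C + c * (1 / (1 - q / ϱ))) * ϱ ^ k := by gcongr
    _ = _ := by rw [mul_one_div]

lemma recursion_le_of_eq {ϱt : ℝ} (hϱ : 0 < ϱ) (hϱt : ϱ < ϱt) (hC : 0 ≤ C) (hc : 0 ≤ c)
    (h0 : u 0 ≤ C) (hu : ∀ k, u (k + 1) ≤ ϱ * u k + c * ϱ ^ (k + 1)) (k : ℕ) :
    u k ≤ Dtil C c ϱ ϱt * ϱt ^ k := by
  have hϱt0 : 0 < ϱt := hϱ.trans hϱt
  refine (recursion_le_sum hϱ h0 hu k).trans ?_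
  have hs : ϱ ^ k = (ϱ / ϱt) ^ k * ϱt ^ k := by rw [← mul_pow, div_mul_cancel₀ _ hϱt0.ne']
  have hs1 : (ϱ / ϱt) ^ k ≤ 1 := pow_le_one₀ (by positivity) ((div_le_one hϱt0).2 hϱt.le)
  have hk := mul_pow_le (show 0 < ϱ / ϱt by positivity) ((div_lt_one hϱt0).2 hϱt) k
  rw [one_div_div, ← Real.log_rpow (by positivity)] at hk
  rw [div_self hϱ.ne', hs]
  simp only [one_pow, Finset.sum_const, Finset.card_range, nsmul_eq_mul, mul_one]
  calc (C + c * k) * ((ϱ / ϱt) ^ k * ϱt ^ k)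
      = (C * (ϱ / ϱt) ^ k + c * (k * (ϱ / ϱt) ^ k)) * ϱt ^ k := by ring
    _ ≤ (C * 1 + c * (1 / Real.log ((ϱt / ϱ) ^ Real.exp 1))) * ϱt ^ k := by gcongr
    _ = _ := by rw [Dtil, mul_one, mul_one_div]

lemma recursion_le_of_gt (hϱ : 0 < ϱ) (hϱq : ϱ < q) (hC : 0 ≤ C) (hc : 0 ≤ c) (h0 : u 0 ≤ C)
    (hu : ∀ k, u (k + 1) ≤ ϱ * u k + c * q ^ (k + 1)) (k : ℕ) :
    u k ≤ (C + c / (1 - ϱ / q)) * q ^ k := by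
  have hq : 0 < q := hϱ.trans hϱq
  have hs0 : 0 < ϱ / q := by positivity
  have hs1 : ϱ / q < 1 := (div_lt_one hq).2 hϱq
  have h : ∀ k, u k ≤ (C + c * ∑ j ∈ Finset.range k, (ϱ / q) ^ j) * q ^ k := by
    intro k
    induction k with
    | zero => simpa using h0
    | succ k ih =>
      calc u (k + 1) ≤ ϱ * u k + c * q ^ (k + 1) := hu k
        _ ≤ ϱ * ((C + c * ∑ j ∈ Finset.range k, (ϱ / q) ^ j) * q ^ k)
              + c * q ^ (k + 1) := by gcongr
        _ = (ϱ / q) * q * ((C + c * ∑ j ∈ Finset.range k, (ϱ / q) ^ j) * q ^ k)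
              + c * q ^ (k + 1) := by rw [div_mul_cancel₀ _ hq.ne']
        _ = (C * (ϱ / q) + c * ∑ j ∈ Finset.range (k + 1), (ϱ / q) ^ j) * q ^ (k + 1) := by
            rw [Finset.sum_range_succ']
            simp_rw [pow_succ (ϱ / q)]
            rw [← Finset.sum_mul]
            ring
        _ ≤ (C * 1 + c * ∑ j ∈ Finset.range (k + 1), (ϱ / q) ^ j) * q ^ (k + 1) := by gcongr
        _ = _ := by rw [mul_one]
  refine (h k).trans ?_
  calc _ ≤ (C + c * (1 / (1 - ϱ / q))) * q ^ k := by
        gcongr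
        exact sum_pow_le hs0.le hs1 k
    _ = _ := by rw [mul_one_div]

/-- In each of the three regimes the recursion decays like `D r ^ k`, and `K`, `δ` and the sample
bound are the corresponding expressions in `D` and `r`. -/
lemma exists_geometric_decay {ϱt : ℝ} (hϱ : 0 < ϱ) (hϱ1 : ϱ < 1) (hϱt : ϱ < ϱt) (hϱt1 : ϱt < 1)
    (hq0 : 0 < q) (hq1 : q < 1) (hC : 0 < C) (hc : 0 ≤ c) (h0 : u 0 ≤ C)
    (hu : ∀ k, u (k + 1) ≤ ϱ * u k + c * q ^ (k + 1)) :
    ∃ D r : ℝ, 0 < D ∧ 0 < r ∧ r < 1 ∧ (∀ k, u k ≤ D * r ^ k) ∧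
      (∀ ε, K C c ϱ ϱt (q ^ 2) ε = Real.log (D / ε) / Real.log (1 / r)) ∧
      0 ≤ delta ϱ ϱt (q ^ 2) ∧
      1 + delta ϱ ϱt (q ^ 2) = Real.log (1 / q) / Real.log (1 / r) ∧
      ∀ ε, Msamp C c ϱ ϱt (q ^ 2) ε =
        (D / ε) ^ (1 + delta ϱ ϱt (q ^ 2)) / (q * Real.log (1 / q)) + K C c ϱ ϱt (q ^ 2) ε := by
  have hlogϱ := log_one_div_pos hϱ hϱ1
  have hlogϱt := log_one_div_pos (hϱ.trans hϱt) hϱt1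
  have hlogq := log_one_div_pos hq0 hq1
  have hdiv : ∀ {a b : ℝ}, 0 < a → 0 < b →
      Real.log (a / b) = Real.log (1 / b) - Real.log (1 / a) := fun ha hb => by
    rw [Real.log_div ha.ne' hb.ne', one_div, one_div, Real.log_inv, Real.log_inv]; ring
  have hsqrt : Real.sqrt (q ^ 2) = q := Real.sqrt_sq hq0.le
  rcases lt_trichotomy q ϱ with hlt | heq | hgt
  · have hcase : q ^ 2 < ϱ ^ 2 := by gcongr
    have hs1 : q / ϱ < 1 := (div_lt_one hϱ).2 hlt
    have hD : Ctil C c ϱ (q ^ 2) = C + c / (1 - q / ϱ) := by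
      rw [Ctil, hsqrt, min_eq_right]
      exact hs1.le.trans ((one_lt_div hq0).2 hlt).le
    have hδ : 1 + delta ϱ ϱt (q ^ 2) = Real.log (1 / q) / Real.log (1 / ϱ) := by
      rw [delta, if_pos hcase, sq_rpow_half hq0, hdiv hϱ hq0]; field_simp; ring
    refine ⟨Ctil C c ϱ (q ^ 2), ϱ, ?_, hϱ, hϱ1, fun k => ?_, fun ε => ?_, ?_, hδ, fun ε => ?_⟩
    · rw [hD]; have := sub_pos.2 hs1; positivity
    · rw [hD]; exact recursion_le_of_lt hϱ hq0 hlt hc h0 hu k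
    · rw [K, if_pos hcase, one_div_mul_eq_div]
    · rw [delta, if_pos hcase, sq_rpow_half hq0]
      exact div_nonneg (Real.log_nonneg ((one_lt_div hq0).2 hlt).le) hlogϱ.le
    · rw [hδ, Msamp, if_pos hcase, sq_rpow_half hq0]
  · subst heq
    have hδ : 1 + delta q ϱt (q ^ 2) = Real.log (1 / q) / Real.log (1 / ϱt) := by
      rw [delta, if_neg (lt_irrefl _), if_pos rfl, hdiv (hϱ.trans hϱt) hq0]; field_simp; ring
    refine ⟨Dtil C c q ϱt, ϱt, ?_, hϱ.trans hϱt, hϱt1, fun k => ?_, fun ε => ?_, ?_, hδ,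
      fun ε => ?_⟩
    · have : 0 < Real.log ((ϱt / q) ^ Real.exp 1) := by
        rw [Real.log_rpow (div_pos (hϱ.trans hϱt) hϱ)]
        exact mul_pos (Real.exp_pos _) (Real.log_pos ((one_lt_div hϱ).2 hϱt))
      rw [Dtil]; positivity
    · exact recursion_le_of_eq hϱ hϱt hC.le hc h0 hu k
    · rw [K, if_neg (lt_irrefl _), if_pos rfl, one_div_mul_eq_div]
    · rw [delta, if_neg (lt_irrefl _), if_pos rfl]
      exact div_nonneg (Real.log_nonneg ((one_lt_div hϱ).2 hϱt).le) hlogϱt.le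
    · rw [hδ, Msamp, if_neg (lt_irrefl _), if_pos rfl, sq_rpow_half hq0]
  · have hlt2 : ϱ ^ 2 < q ^ 2 := by gcongr
    have hs1 : ϱ / q < 1 := (div_lt_one hq0).2 hgt
    have hD : Ctil C c ϱ (q ^ 2) = C + c / (1 - ϱ / q) := by
      rw [Ctil, hsqrt, min_eq_left]
      exact hs1.le.trans ((one_lt_div hϱ).2 hgt).le
    have hδ : delta ϱ ϱt (q ^ 2) = 0 := by rw [delta, if_neg hlt2.not_gt, if_neg hlt2.ne']
    refine ⟨Ctil C c ϱ (q ^ 2), q, ?_, hq0, hq1, fun k => ?_, fun ε => ?_, hδ.ge, ?_, fun ε => ?_⟩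
    · rw [hD]; have := sub_pos.2 hs1; positivity
    · rw [hD]; exact recursion_le_of_gt hϱ hgt hC.le hc h0 hu k
    · rw [K, if_neg hlt2.not_gt, if_neg hlt2.ne', sq_rpow_half hq0, one_div_mul_eq_div]
    · rw [hδ, add_zero, div_self hlogq.ne']
    · rw [hδ, add_zero, Real.rpow_one, Msamp, if_neg hlt2.not_gt, if_neg hlt2.ne',
        sq_rpow_half hq0]

end Recursion

/-! ### Complexity bounds -/

section Thresholds

variable {D r q δ ε : ℝ}

lemma mul_pow_le_of_log_div_le (hD : 0 < D) (hr0 : 0 < r) (hr1 : r < 1) (hε : 0 < ε) {k : ℕ}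
    (hk : Real.log (D / ε) / Real.log (1 / r) ≤ k) : D * r ^ k ≤ ε := by
  rw [div_le_iff₀ (log_one_div_pos hr0 hr1), ← Real.log_pow,
    Real.log_le_log_iff (by positivity) (by positivity), one_div_pow, le_div_iff₀ (by positivity),
    div_mul_eq_mul_div, div_le_one hε] at hk
  exact hk

lemma pow_le_rpow_of_le_log_div (hD : 0 < D) (hq0 : 0 < q) (hq1 : q < 1) (hε : 0 < ε)
    (hδ : 1 + δ = Real.log (1 / q) / Real.log (1 / r)) {k : ℕ}
    (hk : (k : ℝ) ≤ Real.log (D / ε) / Real.log (1 / r)) :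
    (1 / q) ^ k ≤ (D / ε) ^ (1 + δ) := by
  rw [← Real.log_le_log_iff (by positivity) (by positivity), Real.log_pow,
    Real.log_rpow (by positivity), hδ]
  calc k * Real.log (1 / q) ≤ Real.log (D / ε) / Real.log (1 / r) * Real.log (1 / q) :=
        mul_le_mul_of_nonneg_right hk (log_one_div_pos hq0 hq1).le
    _ = _ := by ring

end Thresholds

lemma sum_tau (n : ℕ) : ((∑ j ∈ Finset.range n, tau j : ℕ) : ℝ) = n * (n + 1) / 2 := by
  induction n with
  | zero => simp
  | succ n ih =>
    rw [Finset.sum_range_succ, Nat.cast_add, ih, tau]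
    push_cast
    ring

/-- The batches are rounded up from a geometric sequence of ratio `1 / q`, whose sum is compared
with the integral of `t ↦ (1 / q) ^ t`. -/
lemma sum_batch_le {q : ℝ} (hq0 : 0 < q) (hq1 : q < 1) (k : ℕ) :
    ((∑ j ∈ Finset.range k, batch (q ^ 2) j : ℕ) : ℝ) ≤
      (1 / q) ^ k / (q * Real.log (1 / q)) + k := by
  have hlog := log_one_div_pos hq0 hq1
  induction k with
  | zero =>
    rw [Finset.sum_range_zero, Nat.cast_zero]
    positivity
  | succ k ih =>
    rw [Finset.sum_range_succ, Nat.cast_add]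
    have h1 := batch_le hq0 k
    have h2 : (1 / q) ^ k / (q * Real.log (1 / q)) + (1 / q) ^ (k + 1)
        ≤ (1 / q) ^ (k + 1) / (q * Real.log (1 / q)) := by
      have hle : 1 + Real.log (1 / q) ≤ 1 / q := by
        linarith [Real.log_le_sub_one_of_pos (show 0 < 1 / q by positivity)]
      calc _ = (1 / q) ^ k / (q * Real.log (1 / q)) * (1 + Real.log (1 / q)) := by
            rw [pow_succ]; field_simp
        _ ≤ (1 / q) ^ k / (q * Real.log (1 / q)) * (1 / q) := by gcongr
        _ = _ := by ring
    rw [Nat.cast_succ]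
    linarith

section Asymptotics

variable {D r q δ : ℝ}

lemma tendsto_log_one_div : Tendsto (fun ε : ℝ => Real.log (1 / ε)) (𝓝[>] 0) atTop := by
  simp_rw [one_div]
  exact Real.tendsto_log_atTop.comp tendsto_inv_nhdsGT_zero

lemma const_isBigO_log (c : ℝ) :
    (fun _ : ℝ => c) =O[𝓝[>] 0] fun ε => Real.log (1 / ε) :=
  (isLittleO_const_left.2 (Or.inr (tendsto_norm_atTop_atTop.comp tendsto_log_one_div))).isBigO

lemma log_isBigO_rpow {p : ℝ} (hp : 0 < p) :
    (fun ε : ℝ => Real.log (1 / ε)) =O[𝓝[>] 0] fun ε : ℝ => (1 / ε) ^ p := by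
  have := (isLittleO_log_rpow_atTop hp).comp_tendsto (tendsto_inv_nhdsGT_zero (𝕜 := ℝ))
  simpa [Function.comp_def] using this.isBigO

lemma log_div_isBigO_log (hD : 0 < D) :
    (fun ε : ℝ => Real.log (D / ε) / Real.log (1 / r)) =O[𝓝[>] 0] fun ε => Real.log (1 / ε) := by
  have h : (fun ε : ℝ => Real.log (D / ε)) =O[𝓝[>] 0] fun ε => Real.log (1 / ε) := by
    refine IsBigO.congr' ((const_isBigO_log (Real.log D)).add (isBigO_refl _ _)) ?_
      EventuallyEq.rfl
    filter_upwards [self_mem_nhdsWithin] with ε (hε : 0 < ε)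
    rw [← Real.log_mul hD.ne' (by positivity), mul_one_div]
  exact (h.const_mul_left (Real.log (1 / r))⁻¹).congr_left fun ε => (div_eq_inv_mul _ _).symm

lemma rpow_div_isBigO (hD : 0 < D) (p : ℝ) :
    (fun ε : ℝ => (D / ε) ^ p) =O[𝓝[>] 0] fun ε : ℝ => (1 / ε) ^ p := by
  refine IsBigO.congr' ((isBigO_refl (fun ε : ℝ => (1 / ε) ^ p) (𝓝[>] 0)).const_mul_left (D ^ p))
    ?_ EventuallyEq.rfl
  filter_upwards [self_mem_nhdsWithin] with ε (hε : 0 < ε)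
  rw [← Real.mul_rpow hD.le (by positivity), mul_one_div]

lemma eventually_log_div_nonneg (hD : 0 < D) (hr0 : 0 < r) (hr1 : r < 1) :
    ∀ᶠ ε in 𝓝[>] (0 : ℝ), 0 ≤ Real.log (D / ε) / Real.log (1 / r) := by
  filter_upwards [Ioc_mem_nhdsGT hD] with ε hε
  exact div_nonneg (Real.log_nonneg ((one_le_div hε.1).2 hε.2)) (log_one_div_pos hr0 hr1).le

end Asymptotics

/-- The complexity bounds follow from geometric decay of the mean-squared error. -/
lemma Run.complexity {N m d : ℕ} {Ω : Type*} [MeasurableSpace Ω] {P : Measure Ω}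
    {G : Game N m d} {Y : Set (Vec m)} {A : Matrix (Fin N) (Fin N) ℝ} {α q D r δ : ℝ}
    (S : Run G A α tau (batch (q ^ 2)) Y P) (xs : Fin N → Vec m)
    (hq0 : 0 < q) (hq1 : q < 1) (hD : 0 < D) (hr0 : 0 < r) (hr1 : r < 1)
    (hdecay : ∀ k, S.mse xs k ≤ D * r ^ k)
    (hδ0 : 0 ≤ δ) (hδ : 1 + δ = Real.log (1 / q) / Real.log (1 / r)) (K Ms : ℝ → ℝ)
    (hK : ∀ ε, K ε = Real.log (D / ε) / Real.log (1 / r))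
    (hMs : ∀ ε, Ms ε = (D / ε) ^ (1 + δ) / (q * Real.log (1 / q)) + K ε) :
    (∀ ε : ℝ, 0 < ε →
      (∀ k : ℕ, K ε ≤ k → S.mse xs k ≤ ε) ∧
      S.iters xs ε ≤ ⌈K ε⌉₊ ∧
      (0 ≤ K ε → (S.rounds xs ε : ℝ) ≤ (K ε + 1) * (K ε + 2) / 2) ∧
      (∀ k : ℕ, K ε = k →
        ((∑ j ∈ Finset.range (k + 1), tau j : ℕ) : ℝ) = (K ε + 1) * (K ε + 2) / 2) ∧
      (∀ k : ℕ, K ε = k → (S.samples xs ε : ℝ) ≤ Ms ε) ∧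
      (0 ≤ K ε → (S.samples xs ε : ℝ) ≤ Ms ε + batch (q ^ 2) ⌊K ε⌋₊)) ∧
    K =O[𝓝[>] 0] (fun ε => Real.log (1 / ε)) ∧
    (fun ε => (S.iters xs ε : ℝ)) =O[𝓝[>] 0] (fun ε => Real.log (1 / ε)) ∧
    (fun ε => (K ε + 1) * (K ε + 2) / 2) =O[𝓝[>] 0] (fun ε => Real.log (1 / ε) ^ 2) ∧
    (fun ε => (S.rounds xs ε : ℝ)) =O[𝓝[>] 0] (fun ε => Real.log (1 / ε) ^ 2) ∧
    0 ≤ δ ∧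
    Ms =O[𝓝[>] 0] (fun ε : ℝ => (1 / ε) ^ (1 + δ)) ∧
    (fun ε => (S.samples xs ε : ℝ)) =O[𝓝[>] 0] (fun ε : ℝ => (1 / ε) ^ (1 + δ)) := by
  have hlogq := log_one_div_pos hq0 hq1
  have hmse : ∀ ε : ℝ, 0 < ε → ∀ k : ℕ, K ε ≤ k → S.mse xs k ≤ ε := fun ε hε k hk =>
    (hdecay k).trans (mul_pow_le_of_log_div_le hD hr0 hr1 hε (hK ε ▸ hk))
  have hiters : ∀ ε : ℝ, 0 < ε → S.iters xs ε ≤ ⌈K ε⌉₊ := fun ε hε =>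
    Nat.sInf_le (hmse ε hε _ (Nat.le_ceil _))
  have hbatch : ∀ ε : ℝ, 0 < ε → ∀ k : ℕ, (k : ℝ) ≤ K ε →
      ((∑ j ∈ Finset.range k, batch (q ^ 2) j : ℕ) : ℝ) ≤ Ms ε := fun ε hε k hk => by
    refine (sum_batch_le hq0 hq1 k).trans ?_
    rw [hMs]
    have := pow_le_rpow_of_le_log_div hD hq0 hq1 hε hδ (hK ε ▸ hk)
    gcongr
  have hsamples : ∀ ε : ℝ, 0 < ε → ∀ k : ℕ, ⌈K ε⌉₊ ≤ k →
      (S.samples xs ε : ℝ) ≤ ((∑ j ∈ Finset.range k, batch (q ^ 2) j : ℕ) : ℝ) :=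
    fun ε hε k hk => Nat.cast_le.2 (Finset.sum_le_sum_of_subset
      (Finset.range_subset_range.2 ((hiters ε hε).trans hk)))
  have hsamples_floor : ∀ ε : ℝ, 0 < ε → 0 ≤ K ε →
      (S.samples xs ε : ℝ) ≤ Ms ε + batch (q ^ 2) ⌊K ε⌋₊ := fun ε hε h0 => by
    refine (hsamples ε hε _ (Nat.ceil_le_floor_add_one (K ε))).trans ?_
    rw [Finset.sum_range_succ, Nat.cast_add]
    exact add_le_add_left (hbatch ε hε _ (Nat.floor_le h0)) _
  have hrounds : ∀ ε, (S.rounds xs ε : ℝ) = S.iters xs ε * (S.iters xs ε + 1) / 2 := fun ε =>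
    sum_tau _
  have hKO : K =O[𝓝[>] 0] fun ε => Real.log (1 / ε) := by
    rw [show K = _ from funext hK]; exact log_div_isBigO_log hD
  have hKev : ∀ᶠ ε in 𝓝[>] (0 : ℝ), 0 ≤ K ε := by
    simp_rw [hK]; exact eventually_log_div_nonneg hD hr0 hr1
  have hitersO : (fun ε => (S.iters xs ε : ℝ)) =O[𝓝[>] 0] fun ε => Real.log (1 / ε) := by
    refine IsBigO.trans ?_ (hKO.add (const_isBigO_log 1))
    refine IsBigO.of_bound 1 ?_
    filter_upwards [self_mem_nhdsWithin, hKev] with ε (hε : 0 < ε) h0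
    rw [one_mul, Real.norm_of_nonneg (Nat.cast_nonneg _), Real.norm_of_nonneg (by linarith)]
    exact (Nat.cast_le.2 (hiters ε hε)).trans (Nat.ceil_lt_add_one h0).le
  have hpos : 0 < 1 + δ := by linarith
  have hMsO : Ms =O[𝓝[>] 0] fun ε : ℝ => (1 / ε) ^ (1 + δ) := by
    rw [show Ms = _ from funext hMs]
    refine IsBigO.add ?_ (hKO.trans (log_isBigO_rpow hpos))
    simp_rw [div_eq_inv_mul _ (q * Real.log (1 / q))]
    exact (rpow_div_isBigO hD _).const_mul_left _
  refine ⟨fun ε hε => ⟨hmse ε hε, hiters ε hε, fun h0 => ?_, fun k hk => ?_, fun k hk => ?_,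
    hsamples_floor ε hε⟩, hKO, hitersO, ?_, ?_, hδ0, hMsO, ?_⟩
  · have h1 : (S.iters xs ε : ℝ) ≤ K ε + 1 :=
      (Nat.cast_le.2 (hiters ε hε)).trans (Nat.ceil_lt_add_one h0).le
    rw [hrounds]
    have : (S.iters xs ε : ℝ) + 1 ≤ K ε + 2 := by linarith
    gcongr
  · rw [sum_tau, hk]; push_cast; ring
  · exact (hsamples ε hε k (by rw [hk, Nat.ceil_natCast])).trans (hbatch ε hε k hk.ge)
  · exact (((hKO.add (const_isBigO_log 1)).mul (hKO.add (const_isBigO_log 2))).const_mul_left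
      2⁻¹).congr (fun ε => (div_eq_inv_mul _ _).symm) fun ε => (sq _).symm
  · simp_rw [hrounds]
    exact ((hitersO.mul (hitersO.add (const_isBigO_log 1))).const_mul_left 2⁻¹).congr
      (fun ε => (div_eq_inv_mul _ _).symm) fun ε => (sq _).symm
  · have hsum : (fun ε => Ms ε + ((1 / q) * (D / ε) ^ (1 + δ) + 1)) =O[𝓝[>] 0]
        fun ε : ℝ => (1 / ε) ^ (1 + δ) :=
      hMsO.add (((rpow_div_isBigO hD _).const_mul_left _).add
        ((const_isBigO_log 1).trans (log_isBigO_rpow hpos)))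
    refine IsBigO.trans (IsBigO.of_bound 1 ?_) hsum
    filter_upwards [self_mem_nhdsWithin, hKev] with ε (hε : 0 < ε) h0
    have hle : (S.samples xs ε : ℝ) ≤ Ms ε + ((1 / q) * (D / ε) ^ (1 + δ) + 1) := by
      refine (hsamples_floor ε hε h0).trans (add_le_add_right ((batch_le hq0 _).trans ?_) _)
      have := pow_le_rpow_of_le_log_div hD hq0 hq1 hε hδ (hK ε ▸ Nat.floor_le h0)
      rw [← hK] at this
      rw [pow_succ']
      gcongr
    rw [one_mul, Real.norm_of_nonneg (Nat.cast_nonneg _)]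
    exact hle.trans (Real.le_norm_self _)

end AggNash

theorem theorem4 {N m d : ℕ} {Ω : Type*} [MeasurableSpace Ω] (P : Measure Ω)
    [IsProbabilityMeasure P] (G : AggNash.Game N m d) (Y : Set (AggNash.Vec m))
    (hG : G.Regular Y)
    (𝒢 : SimpleGraph (Fin N)) (A : Matrix (Fin N) (Fin N) ℝ) (hA : AggNash.IsWeightMatrix 𝒢 A)
    (η L : ℝ) (hη : 0 < η) (hL : 0 < L) (hmono : G.StronglyMonotone η) (hLip : G.LipschitzMap L)
    (ℓ : Fin N → ℝ) (hℓ : ∀ i, 0 ≤ ℓ i) (hLipAgg : G.LipschitzAgg Y ℓ)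
    (xs : Fin N → AggNash.Vec m) (hxs : G.IsNash xs) :
    ((∀ i, 0 < A i i) → ∃ θ β : ℝ, AggNash.Mixing A θ β) ∧
    ∀ θ β : ℝ, AggNash.Mixing A θ β →
    ∀ α : ℝ, 0 < α → α < η / L ^ 2 →
    ∀ ϱ : ℝ, ϱ = AggNash.rate α η L → 0 < ϱ →
    ∀ ϱt : ℝ, ϱ < ϱt → ϱt < 1 →
    ∀ S : AggNash.Run G A α AggNash.tau (AggNash.batch β) Y P,
    ∀ ν : Fin N → ℝ, S.Noise ν →
    ∀ C : ℝ, 0 < C → S.mse xs 0 ≤ C →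
    ∀ c₃ : ℝ, c₃ = AggNash.C₃ G.M θ β α ℓ ν →
    ∀ K : ℝ → ℝ, K = AggNash.K C c₃ ϱ ϱt β →
    ∀ δ : ℝ, δ = AggNash.delta ϱ ϱt β →
      (∀ ε : ℝ, 0 < ε →
        (∀ k : ℕ, K ε ≤ k → S.mse xs k ≤ ε) ∧
        S.iters xs ε ≤ ⌈K ε⌉₊ ∧
        (0 ≤ K ε → (S.rounds xs ε : ℝ) ≤ (K ε + 1) * (K ε + 2) / 2) ∧
        (∀ k : ℕ, K ε = k →
          ((∑ j ∈ Finset.range (k + 1), AggNash.tau j : ℕ) : ℝ) = (K ε + 1) * (K ε + 2) / 2) ∧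
        (∀ k : ℕ, K ε = k → (S.samples xs ε : ℝ) ≤ AggNash.Msamp C c₃ ϱ ϱt β ε) ∧
        (0 ≤ K ε → (S.samples xs ε : ℝ) ≤
          AggNash.Msamp C c₃ ϱ ϱt β ε + AggNash.batch β ⌊K ε⌋₊)) ∧
      K =O[𝓝[>] 0] (fun ε => Real.log (1 / ε)) ∧
      (fun ε => (S.iters xs ε : ℝ)) =O[𝓝[>] 0] (fun ε => Real.log (1 / ε)) ∧
      (fun ε => (K ε + 1) * (K ε + 2) / 2) =O[𝓝[>] 0] (fun ε => Real.log (1 / ε) ^ 2) ∧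
      (fun ε => (S.rounds xs ε : ℝ)) =O[𝓝[>] 0] (fun ε => Real.log (1 / ε) ^ 2) ∧
      0 ≤ δ ∧
      AggNash.Msamp C c₃ ϱ ϱt β =O[𝓝[>] 0] (fun ε : ℝ => (1 / ε) ^ (1 + δ)) ∧
      (fun ε => (S.samples xs ε : ℝ)) =O[𝓝[>] 0] (fun ε : ℝ => (1 / ε) ^ (1 + δ)) := by
  refine ⟨hA.exists_mixing, ?_⟩
  rintro θ β hmix α hα hαη ϱ rfl hϱ ϱt hϱt hϱt1 S ν hS C hC hC0 c₃ rfl K rfl δ rfl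
  -- with `β = q ^ 2`, all fractional powers of `β` become natural powers of `q`
  obtain ⟨q, hq0, rfl⟩ : ∃ q : ℝ, 0 < q ∧ β = q ^ 2 :=
    ⟨Real.sqrt β, Real.sqrt_pos.2 hmix.2.1, (Real.sq_sqrt hmix.2.1.le).symm⟩
  have hq1 : q < 1 := (pow_lt_one_iff_of_nonneg hq0.le two_ne_zero).1 hmix.2.2.1
  have hM : 0 ≤ G.M := (Finset.sum_nonneg fun j _ => norm_nonneg (xs j)).trans
    (AggNash.Game.sum_norm_le_M hG fun i => (hxs i).1)
  have hc := AggNash.C₃_nonneg ν hM hmix.1.le hα.le hℓ hq0 hq1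
  obtain ⟨D, r, hD, hr0, hr1, hdecay, hK, hδ0, hδ, hMs⟩ :=
    AggNash.exists_geometric_decay hϱ (hϱt.trans hϱt1) hϱt hϱt1 hq0 hq1 hC hc hC0
      (S.mse_succ_le_geometric hG hmono hLip hℓ hLipAgg hxs hα hq0 hq1 hmix hS)
  exact S.complexity xs hq0 hq1 hD hr0 hr1 hdecay hδ0 hδ _ _ hK hMs
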